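/- Let $\tau>0$ and $\lambda_1,\lambda_2\in\mathbb{R}$, put $x_i(\tau,\lambda_i)=1+\tau(1+\lambda_i)$, and assume $x_1,x_2>0$. **Barnes double gamma function.** For $a_1,a_2>0$ and $\Re w>0$ let $s\mapsto\zeta_2(s,w\,|\,a)$ be the analytic continuation to $\mathbb{C}\setminus\{1,2\}$ of $$\frac{1}{\Gamma(s)}\int_0^\infty \frac{t^{s-1}e^{-wt}}{(1-e^{-a_1t})(1-e^{-a_2t})}\,dt\qquad(\Re s>2),$$ and let $L_2(w\,|\,a)=\partial_s\zeta_2(s,w\,|\,a)|_{s=0}$ and $\Gamma_2(w\,|\,a)=\exp L_2(w\,|\,a)$. From now on the parameter $a$ is $a(\tau)=(1,\tau)$. **The laws.** * $L(\tau)=\exp\bigl(\mathcal N(0,\,4\log 2/\tau)\bigr)$ is lognormal. * For $b=(b_0,b_1,b_2)$, $\beta_{2,2}(a,b)$ is the probability law on $(0,1]$ with $$\mathbf{E}\bigl[\beta_{2,2}(a,b)^q\bigr]=\frac{\Gamma_2(q+b_0|a)}{\Gamma_2(b_0|a)}\,\frac{\Gamma_2(b_0+b_1|a)}{\Gamma_2(q+b_0+b_1|a)}\,\frac{\Gamma_2(b_0+b_2|a)}{\Gamma_2(q+b_0+b_2|a)}\,\frac{\Gamma_2(q+b_0+b_1+b_2|a)}{\Gamma_2(b_0+b_1+b_2|a)}$$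 for $\Re q>-\min(b_0,\,b_0+b_1+b_2)$. The three factors are $X_i(\tau,\lambda)=\beta_{2,2}^{-1}(a,b)$, $i=1,2,3$, where $b=(b_0,b_1,b_2)$ is * $b=\bigl(x_1,\tfrac{x_2-x_1}{2},\tfrac{x_2-x_1}{2}\bigr)$ for $X_1$, * $b=\bigl(\tfrac{x_1+x_2}{2},\tfrac12,\tfrac{\tau}{2}\bigr)$ for $X_2$, * $b=\bigl(1+\tau,\tfrac{x_1+x_2-1-\tau}{2},\tfrac{x_1+x_2-1-\tau}{2}\bigr)$ for $X_3$. * $M_{(a,x)}$, for $x=(x_1,x_2)$, is the probability law on $(0,\infty)$ with $$\mathbf{E}\bigl[M_{(a,x)}^q\bigr]=\frac{\Gamma_2(x_1-q|a)}{\Gamma_2(x_1|a)}\,\frac{\Gamma_2(x_2-q|a)}{\Gamma_2(x_2|a)}\,\frac{\Gamma_2(1+\tau-q|a)}{\Gamma_2(1+\tau|a)}\,\frac{\Gamma_2(x_1+x_2-q|a)}{\Gamma_2(x_1+x_2-2q|a)}$$ for $\Re q<\min(x_1,x_2,1+\tau)$. * $Y(\tau)$ has the density $\tau y^{-1-\tau}e^{-y^{-\tau}}$,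 $y>0$, and the reduced Selberg law is $$M^\star_{(\tau,\lambda_1,\lambda_2)}=2^{-[3(1+\tau)+2\tau(\lambda_1+\lambda_2)]/\tau}\;L(\tau)\,X_1(\tau,\lambda)\,X_2(\tau,\lambda)\,X_3(\tau,\lambda)\,Y(\tau)$$ with independent factors. **Theorem.** The laws $X_i(\tau,\lambda)$, $i=1,2,3$, and $M_{(a,x)}$ are well defined: for each of them exactly one probability law has the stated Mellin transform. Moreover: 1. Under $\tau\to1/\tau$, $\lambda\to\tau\lambda$, the following equalities in law hold: $$L(1/\tau)^{1/\tau}=L(\tau),\qquad X_i(1/\tau,\tau\lambda)^{1/\tau}=X_i(\tau,\lambda)\quad(i=1,2,3),$$ $$M_{(a(1/\tau),\,x(1/\tau,\tau\lambda))}^{1/\tau}=M_{(a(\tau),\,x(\tau,\lambda))}.$$ 2. The reduced Selberg law is not invariant: for every $\tau\neq1$, $\bigl(M^\star_{(1/\tau,\tau\lambda_1,\tau\lambda_2)}\bigr)^{1/\tau}$ and $M^\star_{(\tau,\lambda_1,\lambda_2)}$ have different laws. 3. For all $q\in\mathbb{C}$ with $\Re q<\min(1,\tau,x_1,x_2)$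 both expectations below converge absolutely and $$\mathbf{E}\Bigl[\bigl(M^\star_{(1/\tau,\tau\lambda_1,\tau\lambda_2)}\bigr)^{q/\tau}\Bigr]=\frac{\Gamma(1-q)}{\Gamma(1-q/\tau)}\,\mathbf{E}\Bigl[\bigl(M^\star_{(\tau,\lambda_1,\lambda_2)}\bigr)^{q}\Bigr].$$ -/

import Mathlib

open MeasureTheory ProbabilityTheory Set

noncomputable section

namespace BarnesSelberg

/-! ### Barnes double gamma function -/

/-- The Barnes double zeta function `ζ₂(s, w | a₁, a₂)` in its region of convergence
`2 < Re s`, `0 < Re w`: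
`Γ(s)⁻¹ ∫₀^∞ t^(s-1) e^(-wt) / ((1 - e^(-a₁t)) (1 - e^(-a₂t))) dt`. -/
def zetaIntegral (a₁ a₂ : ℝ) (w s : ℂ) : ℂ :=
  (Complex.Gamma s)⁻¹ * ∫ t : ℝ in Ioi 0,
    (t : ℂ) ^ (s - 1) * Complex.exp (-w * t) /
      (((1 - Real.exp (-a₁ * t)) * (1 - Real.exp (-a₂ * t)) : ℝ) : ℂ)

/-- `Z` is the analytic continuation of `s ↦ ζ₂(s, w | a₁, a₂)` to `ℂ ∖ {1, 2}`.
Since `ℂ ∖ {1, 2}` is connected, `Z` is determined there; its values at `1` and `2`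
(the poles of `ζ₂`) play no role. -/
def IsZetaContinuation (a₁ a₂ : ℝ) (w : ℂ) (Z : ℂ → ℂ) : Prop :=
  DifferentiableOn ℂ Z {1, 2}ᶜ ∧ ∀ s : ℂ, 2 < s.re → Z s = zetaIntegral a₁ a₂ w s

/-- The Barnes double zeta function `s ↦ ζ₂(s, w | a₁, a₂)`, continued to `ℂ ∖ {1, 2}`. -/
def zeta₂ (a₁ a₂ : ℝ) (w : ℂ) : ℂ → ℂ :=
  Classical.epsilon (IsZetaContinuation a₁ a₂ w)

/-- The double log-gamma function `L₂(w | a₁, a₂) = ∂ₛ ζ₂(s, w | a₁, a₂)` at `s = 0`, for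
`0 < Re w`. -/
def logGamma₂ (a₁ a₂ : ℝ) (w : ℂ) : ℂ := deriv (zeta₂ a₁ a₂ w) 0

/-- The Barnes double gamma function `Γ₂(w | a₁, a₂) = exp L₂(w | a₁, a₂)`, for `0 < Re w`. -/
def Gamma₂ (a₁ a₂ : ℝ) (w : ℂ) : ℂ := Complex.exp (logGamma₂ a₁ a₂ w)

/-! ### Laws given by their Mellin transform -/

/-- `μ` is a probability law carried by `S ⊆ (0, ∞)` whose Mellin transform `E[X^q]` converges
absolutely and equals `φ q` for all `q` in `D`. -/
def HasMellin (S : Set ℝ) (D : Set ℂ) (φ : ℂ → ℂ) (μ : Measure ℝ) : Prop :=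
  IsProbabilityMeasure μ ∧ μ Sᶜ = 0 ∧
    ∀ q ∈ D, Integrable (fun x : ℝ => (x : ℂ) ^ q) μ ∧ ∫ x : ℝ, (x : ℂ) ^ q ∂μ = φ q

/-- The alternating sum `(S₂ h)(q | b)` over all subsets of `{b₁, b₂}`. -/
def S₂ (h : ℂ → ℂ) (b₀ b₁ b₂ : ℝ) (q : ℂ) : ℂ :=
  h (q + b₀) - h (q + b₀ + b₁) - h (q + b₀ + b₂) + h (q + b₀ + b₁ + b₂)

/-- `η_{2,2}(q | a, b) = exp ((S₂ L₂)(q | b) - (S₂ L₂)(0 | b))`. -/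
def eta₂₂ (a₁ a₂ b₀ b₁ b₂ : ℝ) (q : ℂ) : ℂ :=
  Complex.exp (S₂ (logGamma₂ a₁ a₂) b₀ b₁ b₂ q - S₂ (logGamma₂ a₁ a₂) b₀ b₁ b₂ 0)

/-- `μ` is the Barnes beta law `β_{2,2}(a, b)`: it lives on `(0, 1]` and its Mellin transform
is `η_{2,2}(q | a, b)` for `Re q > -min (b₀, b₀ + b₁ + b₂)`. For `b₁, b₂ ≥ 0` this half-plane is
`Re q > -b₀`; the minimum also covers the case `b₁, b₂ ≤ 0` (with `b₀ + b₁ + b₂ > 0`), where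
`η_{2,2}(q | a; b₀, b₁, b₂) = η_{2,2}(q | a; b₀ + b₁ + b₂, -b₁, -b₂)`. -/
def IsBarnesBeta₂₂ (a₁ a₂ b₀ b₁ b₂ : ℝ) (μ : Measure ℝ) : Prop :=
  HasMellin (Ioc 0 1) {q : ℂ | -min b₀ (b₀ + b₁ + b₂) < q.re} (eta₂₂ a₁ a₂ b₀ b₁ b₂) μ

/-- The Barnes beta law `β_{2,2}(a, b)`. -/
def barnesBeta₂₂ (a₁ a₂ b₀ b₁ b₂ : ℝ) : Measure ℝ :=
  Classical.epsilon (IsBarnesBeta₂₂ a₁ a₂ b₀ b₁ b₂)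

/-- The law `β_{2,2}⁻¹(a, b)` of `1 / B`, where `B` has law `β_{2,2}(a, b)`. -/
def barnesBetaInv₂₂ (a₁ a₂ b₀ b₁ b₂ : ℝ) : Measure ℝ :=
  (barnesBeta₂₂ a₁ a₂ b₀ b₁ b₂).map (fun x => x⁻¹)

/-- The Mellin transform of `M_(a,x)`. -/
def mellinM (a₁ a₂ x₁ x₂ : ℝ) (q : ℂ) : ℂ :=
  Gamma₂ a₁ a₂ (x₁ - q) / Gamma₂ a₁ a₂ x₁ *
  (Gamma₂ a₁ a₂ (x₂ - q) / Gamma₂ a₁ a₂ x₂) *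
  (Gamma₂ a₁ a₂ (a₁ + a₂ - q) / Gamma₂ a₁ a₂ (a₁ + a₂)) *
  (Gamma₂ a₁ a₂ (x₁ + x₂ - q) / Gamma₂ a₁ a₂ (x₁ + x₂ - 2 * q))

/-- `μ` is the law of `M_(a,x)`: it lives on `(0, ∞)` and has the Mellin transform `mellinM`
for `Re q < min (x₁, x₂, a₁ + a₂)`. -/
def IsLawM (a₁ a₂ x₁ x₂ : ℝ) (μ : Measure ℝ) : Prop :=
  HasMellin (Ioi 0) {q : ℂ | q.re < min (min x₁ x₂) (a₁ + a₂)} (mellinM a₁ a₂ x₁ x₂) μ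

/-- The law of `M_(a,x)`. -/
def lawM (a₁ a₂ x₁ x₂ : ℝ) : Measure ℝ := Classical.epsilon (IsLawM a₁ a₂ x₁ x₂)

/-! ### The components, for `a = (1, τ)` and `x_i = 1 + τ (1 + l_i)` -/

/-- `x(τ, l) = 1 + τ (1 + l)`. -/
def xpar (τ l : ℝ) : ℝ := 1 + τ * (1 + l)

/-- The law of `L(τ) = exp N(0, 4 log 2 / τ)`. -/
def lawL (τ : ℝ) : Measure ℝ :=
  (gaussianReal 0 (Real.toNNReal (4 * Real.log 2 / τ))).map Real.exp

/-- The parameters `(b₀, b₁, b₂)` of the Barnes beta factors `X₁, X₂, X₃` (indices `0, 1, 2`)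
at `a = (1, τ)`, `x = (xpar τ l₁, xpar τ l₂)`. -/
def bpar (τ l₁ l₂ : ℝ) : Fin 3 → ℝ × ℝ × ℝ
  | 0 => (xpar τ l₁, (xpar τ l₂ - xpar τ l₁) / 2, (xpar τ l₂ - xpar τ l₁) / 2)
  | 1 => ((xpar τ l₁ + xpar τ l₂) / 2, 1 / 2, τ / 2)
  | 2 => (1 + τ, (xpar τ l₁ + xpar τ l₂ - 1 - τ) / 2, (xpar τ l₁ + xpar τ l₂ - 1 - τ) / 2)

/-- The law of `X_{i+1}(τ, l)`. -/
def lawX (i : Fin 3) (τ l₁ l₂ : ℝ) : Measure ℝ :=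
  barnesBetaInv₂₂ 1 τ (bpar τ l₁ l₂ i).1 (bpar τ l₁ l₂ i).2.1 (bpar τ l₁ l₂ i).2.2

/-- The Fréchet law of `Y(τ)`, with density `τ y^(-1-τ) exp (-y^(-τ))` on `(0, ∞)`. -/
def lawY (τ : ℝ) : Measure ℝ :=
  (volume.restrict (Ioi 0)).withDensity fun y =>
    ENNReal.ofReal (τ * y ^ (-1 - τ) * Real.exp (-(y ^ (-τ))))

/-- The reduced Selberg law: the law of
`M⋆_(τ,l) = 2^(-(3(1+τ) + 2τ(l₁+l₂))/τ) L(τ) X₁(τ,l) X₂(τ,l) X₃(τ,l) Y(τ)`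
with independent factors. -/
def lawMstar (τ l₁ l₂ : ℝ) : Measure ℝ :=
  ((lawL τ).prod ((lawX 0 τ l₁ l₂).prod
    ((lawX 1 τ l₁ l₂).prod ((lawX 2 τ l₁ l₂).prod (lawY τ))))).map
    fun p => (2 : ℝ) ^ (-(3 * (1 + τ) + 2 * τ * (l₁ + l₂)) / τ) *
      (p.1 * p.2.1 * p.2.2.1 * p.2.2.2.1 * p.2.2.2.2)

/-- The law of `X ^ r`, where `X` has law `μ` (carried by `(0, ∞)`). -/
def powLaw (μ : Measure ℝ) (r : ℝ) : Measure ℝ := μ.map fun x => x ^ r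

end BarnesSelberg

end

noncomputable section

namespace BarnesSelberg

open Filter Asymptotics Topology

/-! ### Analytic continuation of Mellin transforms -/

/-! Everything is read off from Mellin transforms. On the imaginary axis the Mellin transform of a
law on $(0,\infty)$ is the characteristic function of its logarithm, so it determines the law
(`HasMellin.unique`).

The core is the factorization `mellinM_eq`. In the transform of $M_{(a,x)}$ the factor
$\Gamma_2(x_1+x_2-2q)$ is expanded by the duplication formula `logGamma₂_two_mul`. The four double
gammas it produces, together with the remaining ones, regroup exactly into the transforms of
$X_1,X_2,X_3$. The error term is $\log 2\cdot\zeta_2(0,x_1+x_2-2q)$, and $\zeta_2(0,\cdot)$ is a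
quadratic polynomial (`zeta₂_zero`): its $q^2$ part is the lognormal $L$, its linear part is the
power of 2. Hence $M$ is the constant times $L X_1X_2X_3$, and $M^\star$ is $M$ times an independent
$Y$.

The Barnes beta laws exist by a Lévy–Khinchine argument. By `sum_logGamma₂`, $\log\eta_{2,2}$ is the
integral of $e^{-qt}-1$ against an explicit Lévy density (`eta₂₂_eq_exp_integral`). For positive
$b_1,b_2$ this density dominates that of a gamma law, and the difference has finite mass, so the law
is a gamma part convolved with a compound Poisson part.

The same integral yields the involution: the substitution $t\mapsto\tau t$ preserves $dt/t$ and
exchanges the two periods (`eta₂₂_scaling`). So every factor except $Y$ is invariant. The transform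
of $Y$ is $\Gamma(1-q/\tau)$ and becomes $\Gamma(1-q)$, which gives the ratio in the last claim.
Cancelling the zero-free transform of $M$, invariance of $M^\star$ would force
$\Gamma(1+s)=\Gamma(1+s/\tau)$ for all $s>0$, which fails for $\tau\ne1$. -/

lemma isPreconnected_halfPlane_diff (r : ℝ) (P : Set ℂ) (hP : P.Countable) :
    IsPreconnected ({s : ℂ | r < s.re} \ P) := by
  -- An injective continuous map of the plane onto the half-plane, so the claim reduces to
  -- connectedness of the complement of a countable set in ℂ.
  let φ : ℂ → ℂ := fun z => ((r + Real.exp z.re : ℝ) : ℂ) + z.im * Complex.I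
  have hφ : Continuous φ := by fun_prop
  have hinj : Function.Injective φ := by
    intro z w h
    have h1 := congrArg Complex.re h
    have h2 := congrArg Complex.im h
    simp only [φ, Complex.add_re, Complex.add_im, Complex.ofReal_re, Complex.ofReal_im,
      Complex.mul_re, Complex.mul_im, Complex.I_re, Complex.I_im] at h1 h2
    exact Complex.ext (Real.exp_injective (by linarith)) (by linarith)
  have hc : (φ ⁻¹' P).Countable := hP.preimage_of_injOn hinj.injOn
  have h := (hc.isConnected_compl_of_one_lt_rank
    (by rw [Complex.rank_real_complex]; exact_mod_cast Nat.one_lt_two)).isPreconnected.image φ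
      hφ.continuousOn
  convert h using 1
  ext s
  simp only [Set.mem_sdiff, mem_image, mem_compl_iff, mem_preimage]
  constructor
  · rintro ⟨hs, hsP⟩
    have : φ ⟨Real.log (s.re - r), s.im⟩ = s := by
      apply Complex.ext <;> simp [φ, -Complex.ofReal_exp, Real.exp_log (sub_pos.2 hs)]
    exact ⟨_, by rwa [this], this⟩
  · rintro ⟨z, hz, rfl⟩
    refine ⟨?_, hz⟩
    simp [φ, -Complex.ofReal_exp, Real.exp_pos]

lemma isOpen_halfPlane_diff (r : ℝ) : IsOpen ({s : ℂ | r < s.re} \ {1, 2}) :=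
  (isOpen_lt continuous_const Complex.continuous_re).sdiff (Set.toFinite _).isClosed

/-- Uniqueness of analytic continuation from `2 < Re s`. -/
lemma eqOn_of_eq_of_two_lt_re {F G : ℂ → ℂ} {r : ℝ}
    (hF : DifferentiableOn ℂ F ({s : ℂ | r < s.re} \ {1, 2}))
    (hG : DifferentiableOn ℂ G ({s : ℂ | r < s.re} \ {1, 2}))
    (h : ∀ s : ℂ, 2 < s.re → F s = G s) : EqOn F G ({s : ℂ | r < s.re} \ {1, 2}) := by
  have ho := isOpen_halfPlane_diff r
  -- The base point `max 3 (r + 1)` lies in the half-plane, avoids the poles, and has a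
  -- neighbourhood inside `2 < Re s`.
  have hM : 2 < max 3 (r + 1) := lt_of_lt_of_le (by norm_num) (le_max_left _ _)
  refine (hF.analyticOnNhd ho).eqOn_of_preconnected_of_eventuallyEq (hG.analyticOnNhd ho)
    (isPreconnected_halfPlane_diff r _ (Set.toFinite _).countable)
    (z₀ := ((max 3 (r + 1) : ℝ) : ℂ)) ?_ ?_
  · refine ⟨?_, ?_⟩
    · simp only [mem_ofPred_eq, Complex.ofReal_re]
      exact lt_of_lt_of_le (by linarith) (le_max_right _ _)
    · simp only [mem_insert_iff, mem_singleton_iff, not_or]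
      constructor <;> intro hh <;> have := congrArg Complex.re hh <;>
        simp only [Complex.ofReal_re, Complex.one_re, Complex.re_ofNat] at this <;> linarith
  · filter_upwards [(isOpen_lt continuous_const Complex.continuous_re).mem_nhds
      (show (2 : ℝ) < (((max 3 (r + 1) : ℝ) : ℂ)).re by simpa using hM)] with s hs
    exact h s hs

/-- The normalized Mellin transform `Γ(s)⁻¹ ∫ t^(s-1) g(t) dt`. -/
def gammaMellin (g : ℝ → ℂ) (s : ℂ) : ℂ := (Complex.Gamma s)⁻¹ * mellin g s

lemma differentiableAt_gammaMellin {g : ℝ → ℂ} {a b : ℝ} (ha : 0 < a)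
    (hg : ContinuousOn g (Ioi 0)) (htop : g =O[atTop] fun t => Real.exp (-a * t))
    (hbot : g =O[𝓝[>] 0] fun t => t ^ (-b)) {s : ℂ} (hs : b < s.re) :
    DifferentiableAt ℂ (gammaMellin g) s :=
  (Complex.differentiable_one_div_Gamma s).mul
    (mellin_differentiableAt_of_isBigO_rpow_exp ha (hg.locallyIntegrableOn measurableSet_Ioi)
      htop hbot hs)

/-- Immediate from $1/\Gamma(s)=s/\Gamma(s+1)$. This simple zero turns derivatives at 0 of
normalized Mellin transforms into plain integrals. -/
lemma hasDerivAt_one_div_Gamma_zero : HasDerivAt (fun s : ℂ => (Complex.Gamma s)⁻¹) 1 0 := by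
  have h : (fun s : ℂ => (Complex.Gamma s)⁻¹) = fun s => s * (Complex.Gamma (s + 1))⁻¹ :=
    funext Complex.one_div_Gamma_eq_self_mul_one_div_Gamma_add_one
  rw [h]
  have h2 : DifferentiableAt ℂ (fun s : ℂ => (Complex.Gamma (s + 1))⁻¹) 0 :=
    (Complex.differentiable_one_div_Gamma.comp (differentiable_id.add_const (1 : ℂ))) 0
  simpa using! (hasDerivAt_id (0 : ℂ)).mul h2.hasDerivAt

lemma halfPlane_diff_mem_nhds {s : ℂ} {r : ℝ} (hs : r < s.re) (h12 : s ∉ ({1, 2} : Set ℂ)) :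
    ({s : ℂ | r < s.re} \ {1, 2}) ∈ 𝓝 s :=
  (isOpen_halfPlane_diff r).mem_nhds ⟨hs, h12⟩

lemma zero_notMem_pair : (0 : ℂ) ∉ ({1, 2} : Set ℂ) := by simp

/-- If `g = O(t)` at `0`, the continuation of its normalized Mellin transform vanishes at `0` and
has there the derivative `∫ g(t) dt / t`. -/
lemma continuation_deriv_zero {Z : ℂ → ℂ} {f : ℝ → ℂ} {a : ℝ} (ha : 0 < a)
    (hf : ContinuousOn f (Ioi 0)) (htop : f =O[atTop] fun t => Real.exp (-a * t))
    (hbot : f =O[𝓝[>] 0] fun t => t) (hZ : DifferentiableOn ℂ Z {1, 2}ᶜ)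
    (hZf : ∀ s : ℂ, 2 < s.re → Z s = gammaMellin f s) :
    Z 0 = 0 ∧ deriv Z 0 = (∫ t in Ioi (0 : ℝ), f t / t) ∧
      IntegrableOn (fun t : ℝ => f t / t) (Ioi 0) := by
  have hbot' : f =O[𝓝[>] 0] fun t : ℝ => t ^ (-(-1 : ℝ)) := by simpa using hbot
  have hd : ∀ s : ℂ, -1 < s.re → DifferentiableAt ℂ (gammaMellin f) s := fun s hs =>
    differentiableAt_gammaMellin ha hf htop hbot' hs
  have he : EqOn Z (gammaMellin f) ({s : ℂ | -1 < s.re} \ {1, 2}) :=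
    eqOn_of_eq_of_two_lt_re (hZ.mono fun s hs => hs.2)
      (fun s hs => (hd s hs.1).differentiableWithinAt) hZf
  have h0 : ({s : ℂ | -1 < s.re} \ {1, 2}) ∈ 𝓝 (0 : ℂ) :=
    halfPlane_diff_mem_nhds (by simp) zero_notMem_pair
  have hm : DifferentiableAt ℂ (mellin f) 0 := mellin_differentiableAt_of_isBigO_rpow_exp ha
    (hf.locallyIntegrableOn measurableSet_Ioi) htop hbot' (by simp)
  -- In the product rule the derivative of `mellin f` is multiplied by $1/\Gamma(0)=0$, so only its
  -- value at 0 survives.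
  have hder : HasDerivAt (gammaMellin f) (mellin f 0) 0 := by
    simpa using! hasDerivAt_one_div_Gamma_zero.mul hm.hasDerivAt
  have hfun : (fun t : ℝ => (t : ℂ) ^ ((0 : ℂ) - 1) • f t) = fun t : ℝ => f t / t := by
    ext t
    simp only [zero_sub, Complex.cpow_neg_one, smul_eq_mul]
    rw [div_eq_mul_inv, mul_comm]
  refine ⟨?_, ?_, ?_⟩
  · rw [he (mem_of_mem_nhds h0)]; simp [gammaMellin]
  · rw [(he.eventuallyEq_of_mem h0).deriv_eq, hder.deriv, mellin, hfun]
  · rw [← hfun]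
    exact mellinConvergent_of_isBigO_rpow_exp ha (hf.locallyIntegrableOn measurableSet_Ioi) htop
      hbot' (by simp)

/-- `gammaRatio k s = Γ(s + k - 2) / Γ(s)`. -/
def gammaRatio : ℕ → ℂ → ℂ
  | 0, s => ((s - 1) * (s - 2))⁻¹
  | k + 1, s => (s + k - 2) * gammaRatio k s

lemma differentiableOn_gammaRatio (k : ℕ) : DifferentiableOn ℂ (gammaRatio k) {1, 2}ᶜ := by
  induction k with
  | zero =>
    intro s hs
    simp only [mem_compl_iff, mem_insert_iff, mem_singleton_iff, not_or] at hs
    have : (s - 1) * (s - 2) ≠ 0 := mul_ne_zero (sub_ne_zero.2 hs.1) (sub_ne_zero.2 hs.2)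
    have hd : DifferentiableAt ℂ (fun s : ℂ => ((s - 1) * (s - 2))⁻¹) s :=
      DifferentiableAt.inv (by fun_prop) this
    exact hd.differentiableWithinAt
  | succ k ih =>
    have : DifferentiableOn ℂ (fun s : ℂ => (s + k - 2) * gammaRatio k s) {1, 2}ᶜ :=
      DifferentiableOn.mul (by fun_prop) ih
    exact this

lemma gammaRatio_mul_Gamma (k : ℕ) {s : ℂ} (hs : 2 < s.re) :
    gammaRatio k s * Complex.Gamma s = Complex.Gamma (s + k - 2) := by
  induction k with
  | zero =>
    have h1 : s - 1 ≠ 0 := by intro h; have := congrArg Complex.re h; simp at this; linarith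
    have h2 : s - 2 ≠ 0 := by intro h; have := congrArg Complex.re h; simp at this; linarith
    have e1 := Complex.Gamma_add_one _ h1
    have e2 := Complex.Gamma_add_one _ h2
    rw [show s - 1 + 1 = s by ring] at e1
    rw [show s - 2 + 1 = s - 1 by ring] at e2
    rw [gammaRatio, e1, e2]
    simp only [Nat.cast_zero, add_zero]
    field_simp
  | succ k ih =>
    have h : s + k - 2 ≠ 0 := by
      intro h; have := congrArg Complex.re h; simp at this
      have := (Nat.cast_nonneg k : (0 : ℝ) ≤ k)
      linarith
    have e := Complex.Gamma_add_one _ h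
    rw [gammaRatio, mul_assoc, ih, ← e]
    congr 1; push_cast; ring

/-- The factor $e^{-t}$ makes $t^{k-2}$ integrable at infinity, so each term subtracted at the
origin contributes an exact gamma integral, with an explicit continuation. -/
lemma gammaMellin_monomial (k : ℕ) {s : ℂ} (hs : 2 < s.re) :
    MellinConvergent (fun t : ℝ => (t : ℂ) ^ k / (t : ℂ) ^ 2 * Complex.exp (-t)) s ∧
      gammaMellin (fun t : ℝ => (t : ℂ) ^ k / (t : ℂ) ^ 2 * Complex.exp (-t)) s
        = gammaRatio k s := by
  have hk := (Nat.cast_nonneg k : (0 : ℝ) ≤ k)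
  have hre : 0 < (s + k - 2).re := by simp; linarith
  have key : EqOn (fun t : ℝ => (Real.exp (-t) : ℂ) * (t : ℂ) ^ (s + k - 2 - 1))
      (fun t : ℝ => (t : ℂ) ^ (s - 1) • ((t : ℂ) ^ k / (t : ℂ) ^ 2 * Complex.exp (-t)))
      (Ioi 0) := by
    intro t ht
    have ht0 : (t : ℂ) ≠ 0 := Complex.ofReal_ne_zero.2 (ne_of_gt ht)
    simp only [smul_eq_mul]
    rw [show s + k - 2 - 1 = (s - 1) + k - (2 : ℕ) by push_cast; ring, Complex.cpow_sub _ _ ht0,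
      Complex.cpow_add _ _ ht0, Complex.cpow_natCast, Complex.cpow_natCast]
    push_cast
    ring
  refine ⟨(Complex.GammaIntegral_convergent hre).congr_fun key measurableSet_Ioi, ?_⟩
  have hG : Complex.Gamma s ≠ 0 := Complex.Gamma_ne_zero_of_re_pos (by linarith)
  rw [gammaMellin, mellin, ← setIntegral_congr_fun measurableSet_Ioi key]
  have := Complex.Gamma_eq_integral hre
  rw [Complex.GammaIntegral] at this
  rw [← this, ← gammaRatio_mul_Gamma k hs]
  field_simp

/-! ### Continuation through an asymptotic expansion at the origin -/

/-- The remainder of `g` after `n` terms of its regularized expansion at `0`. -/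
def expansionRem (g : ℝ → ℂ) (c : ℕ → ℂ) (n : ℕ) (t : ℝ) : ℂ :=
  g t - ∑ k ∈ Finset.range n, c k * ((t : ℂ) ^ k / (t : ℂ) ^ 2 * Complex.exp (-t))

lemma continuousOn_monomial (k : ℕ) :
    ContinuousOn (fun t : ℝ => (t : ℂ) ^ k / (t : ℂ) ^ 2 * Complex.exp (-t)) (Ioi 0) := by
  have h : ∀ t ∈ Ioi (0 : ℝ), (t : ℂ) ^ 2 ≠ 0 := fun t ht =>
    pow_ne_zero _ (Complex.ofReal_ne_zero.2 (ne_of_gt ht))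
  fun_prop (disch := assumption)

lemma monomial_isBigO_exp (k : ℕ) :
    (fun t : ℝ => (t : ℂ) ^ k / (t : ℂ) ^ 2 * Complex.exp (-t)) =O[atTop]
      fun t => Real.exp (-(1 / 2) * t) := by
  have h1 : (fun t : ℝ => t ^ k * Real.exp (-t)) =o[atTop] fun t => Real.exp (-(1 / 2) * t) := by
    have := (isLittleO_pow_exp_pos_mul_atTop k (show (0 : ℝ) < 1 / 2 by norm_num)).mul_isBigO
      (isBigO_refl (fun t : ℝ => Real.exp (-t)) atTop)
    refine this.congr_right fun t => ?_
    rw [← Real.exp_add]; congr 1; ring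
  refine IsBigO.trans (IsBigO.of_bound 1 ?_) h1.isBigO
  filter_upwards [eventually_ge_atTop 1] with t ht
  have ht0 : 0 < t := by linarith
  rw [norm_mul, norm_div, norm_pow, norm_pow, Complex.norm_real, Real.norm_of_nonneg ht0.le,
    Complex.norm_exp, Complex.neg_re, Complex.ofReal_re, one_mul,
    Real.norm_of_nonneg (by positivity)]
  gcongr
  exact div_le_self (by positivity) (one_le_pow₀ ht)

section Expansion

variable {g : ℝ → ℂ} {c : ℕ → ℂ} {a : ℝ} {n : ℕ}

/-- The hypothesis expands $t^2e^tg$, so multiplying by $e^{-t}/t^2$ yields precisely the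
regularized monomials and lowers the order of the error by 2. -/
lemma expansionRem_isBigO (hc : (fun t : ℝ => (t : ℂ) ^ 2 * Complex.exp t * g t -
      ∑ k ∈ Finset.range n, c k * (t : ℂ) ^ k) =O[𝓝[>] 0] fun t => t ^ n) :
    expansionRem g c n =O[𝓝[>] 0] fun t : ℝ => t ^ (-(2 - n : ℝ)) := by
  have h1 : (fun t : ℝ => Complex.exp (-t)) =O[𝓝[>] 0] fun _ => (1 : ℝ) := by
    have : Tendsto (fun t : ℝ => Complex.exp (-t)) (𝓝[>] 0) (𝓝 (Complex.exp (-(0 : ℝ)))) :=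
      (Continuous.tendsto (by fun_prop) _).mono_left nhdsWithin_le_nhds
    exact this.isBigO_one ℝ
  have h2 : (fun t : ℝ => ((t : ℂ) ^ 2)⁻¹) =O[𝓝[>] 0] fun t : ℝ => (t ^ 2)⁻¹ :=
    IsBigO.of_bound 1 (Eventually.of_forall fun t => by simp)
  refine ((hc.mul h1).mul h2).congr' ?_ ?_
  · filter_upwards [self_mem_nhdsWithin] with t ht
    have ht0 : (t : ℂ) ≠ 0 := Complex.ofReal_ne_zero.2 (ne_of_gt ht)
    have he : Complex.exp (-t) = (Complex.exp t)⁻¹ := Complex.exp_neg _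
    have he0 := Complex.exp_ne_zero (t : ℂ)
    simp only [expansionRem]
    rw [sub_mul, sub_mul, Finset.sum_mul, Finset.sum_mul, he]
    congr 1
    · field_simp
    · exact Finset.sum_congr rfl fun k _ => by field_simp
  · filter_upwards [self_mem_nhdsWithin] with t ht
    rw [mul_one, show -(2 - n : ℝ) = n - (2 : ℕ) by push_cast; ring, Real.rpow_sub ht,
      Real.rpow_natCast, Real.rpow_natCast, div_eq_mul_inv]

/-- The continuation of `gammaMellin g` to `Re s > 2 - n`. -/
def partialContinuation (g : ℝ → ℂ) (c : ℕ → ℂ) (n : ℕ) (s : ℂ) : ℂ :=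
  gammaMellin (expansionRem g c n) s + ∑ k ∈ Finset.range n, c k * gammaRatio k s

variable (ha : 0 < a) (hg : ContinuousOn g (Ioi 0))
  (htop : g =O[atTop] fun t => Real.exp (-a * t))

include ha hg htop

lemma differentiableOn_partialContinuation
    (hc : (fun t : ℝ => (t : ℂ) ^ 2 * Complex.exp t * g t -
      ∑ k ∈ Finset.range n, c k * (t : ℂ) ^ k) =O[𝓝[>] 0] fun t => t ^ n) :
    DifferentiableOn ℂ (partialContinuation g c n) ({s : ℂ | 2 - (n : ℝ) < s.re} \ {1, 2}) := by
  -- The rate $1/2$ is that of the subtracted terms: $t^{k-2}e^{-t}=O(e^{-t/2})$.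
  have ha' : 0 < min a (1 / 2) := by positivity
  have hexp : ∀ b, min a (1 / 2) ≤ b → (fun t => Real.exp (-b * t)) =O[atTop]
      fun t => Real.exp (-(min a (1 / 2)) * t) := by
    intro b hb
    refine IsBigO.of_bound 1 ?_
    filter_upwards [eventually_ge_atTop 0] with t ht
    rw [Real.norm_of_nonneg (Real.exp_pos _).le, Real.norm_of_nonneg (Real.exp_pos _).le, one_mul]
    exact Real.exp_le_exp.2 (by nlinarith)
  have htop' : expansionRem g c n =O[atTop] fun t => Real.exp (-(min a (1 / 2)) * t) := by
    refine (htop.trans (hexp _ (min_le_left _ _))).sub (IsBigO.fun_sum fun k _ => ?_)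
    exact ((monomial_isBigO_exp k).trans (hexp _ (min_le_right _ _))).const_mul_left _
  have hcont : ContinuousOn (expansionRem g c n) (Ioi 0) :=
    hg.sub (continuousOn_finsetSum _ fun k _ => (continuousOn_monomial k).const_mul _)
  have hgm : DifferentiableOn ℂ (gammaMellin (expansionRem g c n))
      ({s : ℂ | 2 - (n : ℝ) < s.re} \ {1, 2}) := fun s hs =>
    (differentiableAt_gammaMellin ha' hcont htop' (expansionRem_isBigO hc)
      hs.1).differentiableWithinAt
  exact hgm.add (DifferentiableOn.fun_sum fun k _ =>
    ((differentiableOn_gammaRatio k).mono fun s hs => hs.2).const_mul _)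

omit ha hg htop in
lemma gammaMellin_expansionRem {s : ℂ} (hs : 2 < s.re) (hgs : MellinConvergent g s) :
    partialContinuation g c n s = gammaMellin g s := by
  have h1 : ∀ k ∈ Finset.range n, IntegrableOn (fun t : ℝ => (t : ℂ) ^ (s - 1) •
      (c k * ((t : ℂ) ^ k / (t : ℂ) ^ 2 * Complex.exp (-t)))) (Ioi 0) := fun k _ =>
    (gammaMellin_monomial k hs).1.const_smul (c k)
  have h2 : mellin (expansionRem g c n) s = mellin g s - ∑ k ∈ Finset.range n,
      c k * mellin (fun t : ℝ => (t : ℂ) ^ k / (t : ℂ) ^ 2 * Complex.exp (-t)) s := by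
    simp only [mellin, expansionRem, smul_sub, Finset.smul_sum]
    rw [integral_sub hgs (integrable_finsetSum _ h1), integral_finsetSum _ h1]
    congr 1
    refine Finset.sum_congr rfl fun k _ => ?_
    rw [← integral_const_mul]
    congr 1; ext t; simp only [smul_eq_mul]; ring
  rw [partialContinuation, gammaMellin, h2, mul_sub, gammaMellin, Finset.mul_sum, sub_add,
    ← Finset.sum_sub_distrib, Finset.sum_eq_zero, sub_zero]
  intro k _
  rw [← (gammaMellin_monomial k hs).2, gammaMellin]
  ring

lemma mellinConvergent_of_expansion (hc : ∀ n, (fun t : ℝ => (t : ℂ) ^ 2 * Complex.exp t * g t -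
      ∑ k ∈ Finset.range n, c k * (t : ℂ) ^ k) =O[𝓝[>] 0] fun t => t ^ n)
    {s : ℂ} (hs : 2 < s.re) : MellinConvergent g s := by
  refine mellinConvergent_of_isBigO_rpow_exp ha (hg.locallyIntegrableOn measurableSet_Ioi) htop
    (b := 2) ?_ hs
  have h := expansionRem_isBigO (hc 0)
  have hg0 : expansionRem g c 0 = g := by ext t; simp [expansionRem]
  simpa [hg0] using h

/-- The partial continuations agree on their common half-planes by the identity theorem, so the
number of terms may depend on `s`: $\lceil 2-\Re s\rceil+1$ always suffices, and near a point it can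
be held fixed. -/
theorem exists_continuation (hc : ∀ n, (fun t : ℝ => (t : ℂ) ^ 2 * Complex.exp t * g t -
      ∑ k ∈ Finset.range n, c k * (t : ℂ) ^ k) =O[𝓝[>] 0] fun t => t ^ n) :
    ∃ Z : ℂ → ℂ, DifferentiableOn ℂ Z {1, 2}ᶜ ∧ ∀ s : ℂ, 2 < s.re → Z s = gammaMellin g s := by
  have hd := fun n => differentiableOn_partialContinuation ha hg htop (hc n)
  have heq : ∀ s : ℂ, 2 < s.re → ∀ n, partialContinuation g c n s = gammaMellin g s :=
    fun s hs n => gammaMellin_expansionRem hs (mellinConvergent_of_expansion ha hg htop hc hs)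
  have hglue : ∀ (s : ℂ) (n m : ℕ), s ∉ ({1, 2} : Set ℂ) → 2 - (n : ℝ) < s.re →
      2 - (m : ℝ) < s.re → partialContinuation g c n s = partialContinuation g c m s := by
    intro s n m h12 hn hm
    refine eqOn_of_eq_of_two_lt_re (r := max (2 - (n : ℝ)) (2 - m))
      ((hd n).mono fun z hz => ⟨(le_max_left _ _).trans_lt (show _ < z.re from hz.1), hz.2⟩)
      ((hd m).mono fun z hz => ⟨(le_max_right _ _).trans_lt (show _ < z.re from hz.1), hz.2⟩)
      (fun z hz => by rw [heq z hz, heq z hz]) ⟨max_lt hn hm, h12⟩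
  have hN : ∀ s : ℂ, 2 - ((⌈2 - s.re⌉₊ + 1 : ℕ) : ℝ) < s.re := fun s => by
    have := Nat.le_ceil (2 - s.re); push_cast; linarith
  refine ⟨fun s => partialContinuation g c (⌈2 - s.re⌉₊ + 1) s, fun s hs => ?_,
    fun s hs => heq s hs _⟩
  have hmem := halfPlane_diff_mem_nhds (hN s) hs
  have hda : DifferentiableAt ℂ (partialContinuation g c (⌈2 - s.re⌉₊ + 1)) s :=
    (hd _).differentiableAt hmem
  refine (hda.congr_of_eventuallyEq ?_).differentiableWithinAt
  filter_upwards [hmem] with z hz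
  exact hglue z _ _ hz.2 (hN z) hz.1

/-- Three terms reach `Re s > -1`. At 0 the remainder is killed by $1/\Gamma$, and `gammaRatio`
takes the values $1/2,-1,1$ for $k=0,1,2$. -/
theorem continuation_zero (hc : ∀ n, (fun t : ℝ => (t : ℂ) ^ 2 * Complex.exp t * g t -
      ∑ k ∈ Finset.range n, c k * (t : ℂ) ^ k) =O[𝓝[>] 0] fun t => t ^ n)
    {Z : ℂ → ℂ} (hZ : DifferentiableOn ℂ Z {1, 2}ᶜ)
    (hZg : ∀ s : ℂ, 2 < s.re → Z s = gammaMellin g s) :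
    Z 0 = c 0 / 2 - c 1 + c 2 := by
  have h := eqOn_of_eq_of_two_lt_re (hZ.mono fun s hs => hs.2)
    (differentiableOn_partialContinuation ha hg htop (hc 3)) (fun s hs => by
      rw [hZg s hs, gammaMellin_expansionRem hs (mellinConvergent_of_expansion ha hg htop hc hs)])
    (show (0 : ℂ) ∈ _ from ⟨by simp only [mem_ofPred_eq]; norm_num, zero_notMem_pair⟩)
  rw [h, partialContinuation, gammaMellin, Complex.Gamma_zero, inv_zero, zero_mul]
  simp [Finset.sum_range_succ, gammaRatio]
  ring

end Expansion

/-! ### The Barnes double zeta function -/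

/-- `e^(-wt) / ((1 - e^(-a₁t)) (1 - e^(-a₂t)))`. -/
def barnesKernel (a₁ a₂ : ℝ) (w : ℂ) (t : ℝ) : ℂ :=
  Complex.exp (-w * t) / (((1 - Real.exp (-a₁ * t)) * (1 - Real.exp (-a₂ * t)) : ℝ) : ℂ)

lemma zetaIntegral_eq (a₁ a₂ : ℝ) (w s : ℂ) :
    zetaIntegral a₁ a₂ w s = gammaMellin (barnesKernel a₁ a₂ w) s := by
  simp only [zetaIntegral, gammaMellin, mellin, barnesKernel, smul_eq_mul, mul_div_assoc]

lemma one_sub_exp_pos {a t : ℝ} (ha : 0 < a) (ht : 0 < t) : 0 < 1 - Real.exp (-a * t) := by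
  have : Real.exp (-a * t) < 1 := by
    rw [← Real.exp_zero]; exact Real.exp_lt_exp.2 (by nlinarith)
  linarith

/-- The analytic function `z ↦ z / (1 - e^(-az))`. -/
def todd (a : ℝ) (z : ℂ) : ℂ := (dslope (fun z : ℂ => 1 - Complex.exp (-a * z)) 0 z)⁻¹

lemma todd_of_ne (a : ℝ) {z : ℂ} (hz : z ≠ 0) : todd a z = z / (1 - Complex.exp (-a * z)) := by
  rw [todd, dslope_of_ne _ hz, slope_def_field]
  simp

lemma todd_zero (a : ℝ) : todd a 0 = (a : ℂ)⁻¹ := by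
  have h : HasDerivAt (fun z : ℂ => 1 - Complex.exp (-a * z)) a 0 := by
    have h1 : HasDerivAt (fun z : ℂ => -(a : ℂ) * z) (-a) 0 := by
      simpa using (hasDerivAt_id (0 : ℂ)).const_mul (-(a : ℂ))
    simpa using h1.cexp.const_sub 1
  rw [todd, dslope_same, h.deriv]

lemma analyticAt_todd {a : ℝ} (ha : a ≠ 0) : AnalyticAt ℂ (todd a) 0 := by
  have h1 : AnalyticAt ℂ (fun z : ℂ => 1 - Complex.exp (-a * z)) 0 := by fun_prop
  obtain ⟨p, hp⟩ := h1
  have h2 : AnalyticAt ℂ (dslope (fun z : ℂ => 1 - Complex.exp (-a * z)) 0) 0 :=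
    ⟨_, hp.has_fpower_series_dslope_fslope⟩
  refine h2.inv fun h => ?_
  have := todd_zero a
  rw [todd, h, inv_zero] at this
  exact inv_ne_zero (Complex.ofReal_ne_zero.2 ha) this.symm

/-- The odd part of `todd` is linear: `todd a z - todd a (-z) = z`. Differentiating at 0 gives twice
the derivative on the left. -/
lemma deriv_todd_zero {a : ℝ} (ha : 0 < a) : deriv (todd a) 0 = 1 / 2 := by
  have hd := (analyticAt_todd ha.ne').differentiableAt.hasDerivAt
  have hd' : HasDerivAt (fun z => todd a (-z)) (-deriv (todd a) 0) 0 := by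
    have h0 : HasDerivAt (todd a) (deriv (todd a) 0) (-(0 : ℂ)) := by simpa using hd
    simpa using! h0.comp (0 : ℂ) (hasDerivAt_neg (0 : ℂ))
  have hsub := hd.sub hd'
  have hev : ∀ᶠ z in 𝓝 (0 : ℂ), (todd a - fun z => todd a (-z)) z = z := by
    have hU : ∀ᶠ z in 𝓝 (0 : ℂ), todd a z ≠ 0 :=
      (analyticAt_todd ha.ne').continuousAt.eventually_ne
        (by rw [todd_zero]; exact inv_ne_zero (Complex.ofReal_ne_zero.2 ha.ne'))
    filter_upwards [hU] with z hz
    by_cases h0 : z = 0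
    · simp [h0]
    simp only [Pi.sub_apply]
    rw [todd_of_ne a h0] at hz ⊢
    rw [todd_of_ne a (neg_ne_zero.2 h0)]
    have h1 : 1 - Complex.exp (-a * z) ≠ 0 := fun h => hz (by rw [h, div_zero])
    have he : Complex.exp (-a * -z) = (Complex.exp (-a * z))⁻¹ := by
      rw [← Complex.exp_neg]; congr 1; ring
    have h2 : Complex.exp (-a * z) ≠ 0 := Complex.exp_ne_zero _
    rw [he]
    generalize Complex.exp (-a * z) = E at *
    have h3 : 1 - E⁻¹ ≠ 0 := by
      intro h; apply h1; field_simp at h; linear_combination -h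
    have h4 : E - 1 ≠ 0 := fun h => h1 (by linear_combination -h)
    rw [show 1 - E⁻¹ = -(1 - E) / E by field_simp; ring]
    field_simp
  have := hsub.unique ((hasDerivAt_id (0 : ℂ)).congr_of_eventuallyEq hev)
  linear_combination this / 2

section Kernel

variable {a₁ a₂ : ℝ} (h₁ : 0 < a₁) (h₂ : 0 < a₂)

include h₁ h₂

lemma barnesKernel_den_pos {t : ℝ} (ht : 0 < t) :
    0 < (1 - Real.exp (-a₁ * t)) * (1 - Real.exp (-a₂ * t)) :=
  mul_pos (one_sub_exp_pos h₁ ht) (one_sub_exp_pos h₂ ht)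

lemma continuousOn_barnesKernel (w : ℂ) : ContinuousOn (barnesKernel a₁ a₂ w) (Ioi 0) := by
  have : ∀ t ∈ Ioi (0 : ℝ),
      (((1 - Real.exp (-a₁ * t)) * (1 - Real.exp (-a₂ * t)) : ℝ) : ℂ) ≠ 0 := fun t ht =>
    Complex.ofReal_ne_zero.2 (barnesKernel_den_pos h₁ h₂ ht).ne'
  refine ContinuousOn.div (by fun_prop) (Continuous.continuousOn ?_) this
  exact Complex.continuous_ofReal.comp (by fun_prop)

lemma barnesKernel_isBigO_exp {w : ℂ} {a : ℝ} (ha : a ≤ w.re) :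
    barnesKernel a₁ a₂ w =O[atTop] fun t => Real.exp (-a * t) := by
  refine IsBigO.of_bound (((1 - Real.exp (-a₁ * 1)) * (1 - Real.exp (-a₂ * 1)))⁻¹) ?_
  filter_upwards [eventually_ge_atTop 1] with t ht
  have ht0 : 0 < t := by linarith
  have hp := barnesKernel_den_pos h₁ h₂ ht0
  rw [barnesKernel, norm_div, Complex.norm_exp, Complex.norm_real, Real.norm_of_nonneg hp.le,
    Real.norm_of_nonneg (Real.exp_pos _).le, div_eq_inv_mul]
  have hre : (-w * (t : ℂ)).re = -w.re * t := by simp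
  rw [hre]
  have e1 := one_sub_exp_pos h₁ one_pos
  have e2 := one_sub_exp_pos h₂ one_pos
  have m1 : Real.exp (-a₁ * t) ≤ Real.exp (-a₁ * 1) := Real.exp_le_exp.2 (by nlinarith)
  have m2 : Real.exp (-a₂ * t) ≤ Real.exp (-a₂ * 1) := Real.exp_le_exp.2 (by nlinarith)
  refine mul_le_mul ?_ (Real.exp_le_exp.2 (by nlinarith)) (Real.exp_pos _).le (by positivity)
  exact inv_anti₀ (mul_pos e1 e2) (mul_le_mul (by linarith) (by linarith) e2.le
    (one_sub_exp_pos h₁ ht0).le)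

/-- The function `t² e^t e^(-wt) / ((1 - e^(-a₁t)) (1 - e^(-a₂t)))`, continued analytically. -/
def barnesGerm (a₁ a₂ : ℝ) (w : ℂ) (z : ℂ) : ℂ :=
  todd a₁ z * todd a₂ z * Complex.exp ((1 - w) * z)

omit h₁ h₂ in
lemma barnesGerm_ofReal (w : ℂ) {t : ℝ} (ht : t ≠ 0) :
    barnesGerm a₁ a₂ w t = (t : ℂ) ^ 2 * Complex.exp t * barnesKernel a₁ a₂ w t := by
  have ht' : (t : ℂ) ≠ 0 := Complex.ofReal_ne_zero.2 ht
  rw [barnesGerm, todd_of_ne _ ht', todd_of_ne _ ht', barnesKernel,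
    show (1 - w) * (t : ℂ) = t + -w * t by ring, Complex.exp_add]
  push_cast
  rw [div_mul_div_comm]
  ring

lemma analyticAt_barnesGerm (w : ℂ) : AnalyticAt ℂ (barnesGerm a₁ a₂ w) 0 :=
  ((analyticAt_todd h₁.ne').mul (analyticAt_todd h₂.ne')).mul (by fun_prop)

/-- Taylor coefficients of `barnesGerm` at `0`. -/
def barnesCoeff (a₁ a₂ : ℝ) (w : ℂ) (n : ℕ) : ℂ :=
  iteratedDeriv n (barnesGerm a₁ a₂ w) 0 / n.factorial

lemma barnesKernel_expansion (w : ℂ) (n : ℕ) :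
    (fun t : ℝ => (t : ℂ) ^ 2 * Complex.exp t * barnesKernel a₁ a₂ w t -
      ∑ k ∈ Finset.range n, barnesCoeff a₁ a₂ w k * (t : ℂ) ^ k) =O[𝓝[>] 0] fun t => t ^ n := by
  have h := (analyticAt_barnesGerm h₁ h₂ w).hasFPowerSeriesAt.isBigO_sub_partialSum_pow n
  have hT : Tendsto (fun t : ℝ => (t : ℂ)) (𝓝[>] 0) (𝓝 0) := by
    have : Tendsto (fun t : ℝ => (t : ℂ)) (𝓝 0) (𝓝 ((0 : ℝ) : ℂ)) :=
      Complex.continuous_ofReal.tendsto 0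
    simpa using this.mono_left nhdsWithin_le_nhds
  refine (h.comp_tendsto hT).congr' ?_ ?_
  · filter_upwards [self_mem_nhdsWithin] with t ht
    simp only [Function.comp_apply, zero_add]
    rw [barnesGerm_ofReal w (ne_of_gt ht)]
    congr 1
    simp [FormalMultilinearSeries.partialSum, barnesCoeff, mul_comm]
  · filter_upwards [self_mem_nhdsWithin] with t ht
    simp [abs_of_pos (show 0 < t from ht)]

/-- With $T$ the product of the two Todd functions, the germ is $T(z)e^{(1-w)z}$, and the Leibniz
rule collapses the combination to $T(0)w^2/2-T'(0)w+T''(0)/2$. The last constant is left unevaluated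
because only differences in `w` are needed for `mellinM_eq`. -/
lemma barnesCoeff_combination (w : ℂ) :
    barnesCoeff a₁ a₂ w 0 / 2 - barnesCoeff a₁ a₂ w 1 + barnesCoeff a₁ a₂ w 2 =
      w ^ 2 / (2 * a₁ * a₂) - (a₁ + a₂) / (2 * a₁ * a₂) * w +
        iteratedDeriv 2 (fun z => todd a₁ z * todd a₂ z) 0 / 2 := by
  have ht : AnalyticAt ℂ (fun z => todd a₁ z * todd a₂ z) 0 :=
    (analyticAt_todd h₁.ne').mul (analyticAt_todd h₂.ne')
  have hE : AnalyticAt ℂ (fun z => Complex.exp ((1 - w) * z)) 0 := by fun_prop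
  have hd : deriv (fun z => todd a₁ z * todd a₂ z) 0 = (a₁ + a₂) / (2 * a₁ * a₂) := by
    rw [deriv_fun_mul (analyticAt_todd h₁.ne').differentiableAt
      (analyticAt_todd h₂.ne').differentiableAt, deriv_todd_zero h₁, deriv_todd_zero h₂,
      todd_zero, todd_zero]
    have : (a₁ : ℂ) ≠ 0 := Complex.ofReal_ne_zero.2 h₁.ne'
    have : (a₂ : ℂ) ≠ 0 := Complex.ofReal_ne_zero.2 h₂.ne'
    field_simp
  have hL : ∀ n, iteratedDeriv n (barnesGerm a₁ a₂ w) 0 = _ := fun n =>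
    iteratedDeriv_fun_mul (n := n) (f := fun z => todd a₁ z * todd a₂ z) ht.contDiffAt
      hE.contDiffAt
  have : (a₁ : ℂ) ≠ 0 := Complex.ofReal_ne_zero.2 h₁.ne'
  have : (a₂ : ℂ) ≠ 0 := Complex.ofReal_ne_zero.2 h₂.ne'
  simp only [barnesCoeff, hL, Finset.sum_range_succ, Finset.sum_range_zero,
    iteratedDeriv_cexp_const_mul, iteratedDeriv_zero, iteratedDeriv_one, hd, todd_zero]
  simp
  field_simp
  ring

lemma isZetaContinuation_zeta₂ {w : ℂ} (hw : 0 < w.re) :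
    IsZetaContinuation a₁ a₂ w (zeta₂ a₁ a₂ w) := by
  refine Classical.epsilon_spec (p := IsZetaContinuation a₁ a₂ w) ?_
  obtain ⟨Z, hZ, hZ'⟩ := exists_continuation hw (continuousOn_barnesKernel h₁ h₂ w)
    (barnesKernel_isBigO_exp h₁ h₂ le_rfl) (barnesKernel_expansion h₁ h₂ w)
  exact ⟨Z, hZ, fun s hs => by rw [hZ' s hs, zetaIntegral_eq]⟩

lemma zeta₂_eq_gammaMellin {w s : ℂ} (hw : 0 < w.re) (hs : 2 < s.re) :
    zeta₂ a₁ a₂ w s = gammaMellin (barnesKernel a₁ a₂ w) s := by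
  rw [(isZetaContinuation_zeta₂ h₁ h₂ hw).2 s hs, zetaIntegral_eq]

lemma mellinConvergent_barnesKernel {w s : ℂ} (hw : 0 < w.re) (hs : 2 < s.re) :
    MellinConvergent (barnesKernel a₁ a₂ w) s :=
  mellinConvergent_of_expansion hw (continuousOn_barnesKernel h₁ h₂ w)
    (barnesKernel_isBigO_exp h₁ h₂ le_rfl) (barnesKernel_expansion h₁ h₂ w) hs

lemma differentiableAt_zeta₂ {w : ℂ} (hw : 0 < w.re) :
    DifferentiableAt ℂ (zeta₂ a₁ a₂ w) 0 :=
  (isZetaContinuation_zeta₂ h₁ h₂ hw).1.differentiableAt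
    ((Set.toFinite {1, 2}).isClosed.isOpen_compl.mem_nhds zero_notMem_pair)

/-- The value `ζ₂(0, w)` is a quadratic polynomial in `w`. -/
theorem zeta₂_zero {w : ℂ} (hw : 0 < w.re) :
    zeta₂ a₁ a₂ w 0 = w ^ 2 / (2 * a₁ * a₂) - (a₁ + a₂) / (2 * a₁ * a₂) * w +
      iteratedDeriv 2 (fun z => todd a₁ z * todd a₂ z) 0 / 2 := by
  rw [← barnesCoeff_combination h₁ h₂ w]
  exact continuation_zero hw (continuousOn_barnesKernel h₁ h₂ w)
    (barnesKernel_isBigO_exp h₁ h₂ le_rfl) (barnesKernel_expansion h₁ h₂ w)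
    (isZetaContinuation_zeta₂ h₁ h₂ hw).1 fun s hs => zeta₂_eq_gammaMellin h₁ h₂ hw hs

/-- A linear combination of double log-gamma values, when the kernels combine to `O(t)` at `0`. -/
theorem sum_logGamma₂ {ι : Type*} (J : Finset ι) (c w : ι → ℂ) {a : ℝ} (ha : 0 < a)
    (hw : ∀ j, a ≤ (w j).re)
    (hO : (fun t => ∑ j ∈ J, c j * barnesKernel a₁ a₂ (w j) t) =O[𝓝[>] 0] fun t => t) :
    ∑ j ∈ J, c j * logGamma₂ a₁ a₂ (w j) =
      ∫ t in Ioi (0 : ℝ), (∑ j ∈ J, c j * barnesKernel a₁ a₂ (w j) t) / t := by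
  have hw' : ∀ j, 0 < (w j).re := fun j => ha.trans_le (hw j)
  have h := (continuation_deriv_zero (Z := fun s => ∑ j ∈ J, c j * zeta₂ a₁ a₂ (w j) s) ha
    (continuousOn_finsetSum _ fun j _ => (continuousOn_barnesKernel h₁ h₂ (w j)).const_mul (c j))
    (IsBigO.fun_sum fun j _ => (barnesKernel_isBigO_exp h₁ h₂ (hw j)).const_mul_left (c j)) hO
    (DifferentiableOn.fun_sum fun j _ =>
      (isZetaContinuation_zeta₂ h₁ h₂ (hw' j)).1.const_mul (c j)) ?_).2.1
  · rw [← h, deriv_fun_sum fun j _ => (differentiableAt_zeta₂ h₁ h₂ (hw' j)).const_mul (c j)]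
    refine Finset.sum_congr rfl fun j _ => ?_
    rw [deriv_const_mul _ (differentiableAt_zeta₂ h₁ h₂ (hw' j)), logGamma₂]
  · intro s hs
    have hi : ∀ j ∈ J, IntegrableOn (fun t : ℝ => (t : ℂ) ^ (s - 1) •
        (c j * barnesKernel a₁ a₂ (w j) t)) (Ioi 0) := fun j _ =>
      (mellinConvergent_barnesKernel h₁ h₂ (hw' j) hs).const_smul (c j)
    simp only [gammaMellin, mellin, Finset.smul_sum]
    rw [integral_finsetSum _ hi, Finset.mul_sum]
    refine Finset.sum_congr rfl fun j _ => ?_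
    rw [zeta₂_eq_gammaMellin h₁ h₂ (hw' j) hs, gammaMellin, mellin, mul_left_comm,
      ← integral_const_mul]
    congr 2; ext t; simp only [smul_eq_mul]; ring

/-! ### The duplication formula -/

/-- Duplication: `ζ₂(s, 2w) = 2^(-s) ∑ ζ₂(s, w + (k₁a₁ + k₂a₂)/2)`, over `k₁, k₂ ∈ {0, 1}`. -/
theorem zeta₂_two_mul {w : ℂ} (hw : 0 < w.re) {s : ℂ} (hs : s ∉ ({1, 2} : Set ℂ)) :
    zeta₂ a₁ a₂ (2 * w) s = (2 : ℂ) ^ (-s) * (zeta₂ a₁ a₂ w s + zeta₂ a₁ a₂ (w + a₁ / 2) s +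
      zeta₂ a₁ a₂ (w + a₂ / 2) s + zeta₂ a₁ a₂ (w + a₁ / 2 + a₂ / 2) s) := by
  have r0 : 0 < (2 * w).re := by simpa using hw
  have r1 : 0 < (w + a₁ / 2).re := by simp; positivity
  have r2 : 0 < (w + a₂ / 2).re := by simp; positivity
  have r3 : 0 < (w + a₁ / 2 + a₂ / 2).re := by simp; positivity
  have hd := fun {w : ℂ} (hw : 0 < w.re) => (isZetaContinuation_zeta₂ h₁ h₂ hw).1.mono
    (fun z (hz : z ∈ {z : ℂ | s.re - 1 < z.re} \ {1, 2}) => hz.2)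
  have hp : Differentiable ℂ fun s : ℂ => (2 : ℂ) ^ (-s) := by
    intro z; exact (differentiableAt_id.neg).const_cpow (Or.inl two_ne_zero)
  refine eqOn_of_eq_of_two_lt_re (r := s.re - 1) (hd r0)
    (hp.differentiableOn.mul ((((hd hw).add (hd r1)).add (hd r2)).add (hd r3))) ?_
    ⟨by simp, hs⟩
  intro z hz
  simp only [Pi.mul_apply, Pi.add_apply]
  rw [zeta₂_eq_gammaMellin h₁ h₂ r0 hz, zeta₂_eq_gammaMellin h₁ h₂ hw hz,
    zeta₂_eq_gammaMellin h₁ h₂ r1 hz, zeta₂_eq_gammaMellin h₁ h₂ r2 hz,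
    zeta₂_eq_gammaMellin h₁ h₂ r3 hz]
  have c0 := mellinConvergent_barnesKernel h₁ h₂ hw hz
  have c1 := mellinConvergent_barnesKernel h₁ h₂ r1 hz
  have c2 := mellinConvergent_barnesKernel h₁ h₂ r2 hz
  have c3 := mellinConvergent_barnesKernel h₁ h₂ r3 hz
  -- With $A=e^{-a_1t/2}$ and $B=e^{-a_2t/2}$, the identity is
  -- $\frac1{(1-A)(1-B)}=\frac{1+A+B+AB}{(1-A^2)(1-B^2)}$; the four numerator terms are the four
  -- shifts of `w`.
  have hsum : mellin (fun t => barnesKernel a₁ a₂ (2 * w) (2⁻¹ * t)) z =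
      mellin (barnesKernel a₁ a₂ w) z + mellin (barnesKernel a₁ a₂ (w + a₁ / 2)) z +
      mellin (barnesKernel a₁ a₂ (w + a₂ / 2)) z +
      mellin (barnesKernel a₁ a₂ (w + a₁ / 2 + a₂ / 2)) z := by
    have d1 := hasMellin_add c0 c1
    have d2 := hasMellin_add d1.1 c2
    have d3 := hasMellin_add d2.1 c3
    rw [← d1.2, ← d2.2, ← d3.2]
    refine setIntegral_congr_fun measurableSet_Ioi fun t ht => ?_
    simp only
    congr 1
    have p1 := (one_sub_exp_pos h₁ (half_pos ht)).ne'
    have p2 := (one_sub_exp_pos h₂ (half_pos ht)).ne'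
    have q1 := (one_sub_exp_pos h₁ ht).ne'
    have q2 := (one_sub_exp_pos h₂ ht).ne'
    have e1 : Real.exp (-a₁ * t) = Real.exp (-a₁ * (t / 2)) ^ 2 := by
      rw [← Real.exp_nat_mul]; congr 1; push_cast; ring
    have e2 : Real.exp (-a₂ * t) = Real.exp (-a₂ * (t / 2)) ^ 2 := by
      rw [← Real.exp_nat_mul]; congr 1; push_cast; ring
    have f1 : Complex.exp (-(w + a₁ / 2) * t) =
        Complex.exp (-w * t) * (Real.exp (-a₁ * (t / 2)) : ℝ) := by
      push_cast; rw [← Complex.exp_add]; congr 1; ring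
    have f2 : Complex.exp (-(w + a₂ / 2) * t) =
        Complex.exp (-w * t) * (Real.exp (-a₂ * (t / 2)) : ℝ) := by
      push_cast; rw [← Complex.exp_add]; congr 1; ring
    have f3 : Complex.exp (-(w + a₁ / 2 + a₂ / 2) * t) =
        Complex.exp (-w * t) * (Real.exp (-a₁ * (t / 2)) : ℝ) *
          (Real.exp (-a₂ * (t / 2)) : ℝ) := by
      push_cast; rw [← Complex.exp_add, ← Complex.exp_add]; congr 1; ring
    have f0 : Complex.exp (-(2 * w) * ((2⁻¹ * t : ℝ) : ℂ)) = Complex.exp (-w * t) := by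
      congr 1; push_cast; ring
    simp only [barnesKernel]
    rw [f0, f1, f2, f3, show 2⁻¹ * t = t / 2 by ring]
    rw [e1] at q1 ⊢
    rw [e2] at q2 ⊢
    generalize Real.exp (-a₁ * (t / 2)) = A at *
    generalize Real.exp (-a₂ * (t / 2)) = B at *
    rw [← Complex.ofReal_ne_zero] at p1 p2 q1 q2
    push_cast at p1 p2 q1 q2 ⊢
    have g1 : (1 : ℂ) + A ≠ 0 := fun h => q1 (by linear_combination (1 - (A : ℂ)) * h)
    have g2 : (1 : ℂ) + B ≠ 0 := fun h => q2 (by linear_combination (1 - (B : ℂ)) * h)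
    rw [show (1 : ℂ) - A ^ 2 = (1 - A) * (1 + A) by ring,
      show (1 : ℂ) - B ^ 2 = (1 - B) * (1 + B) by ring]
    field_simp
    ring
  rw [mellin_comp_mul_left _ _ (by norm_num : (0 : ℝ) < 2⁻¹)] at hsum
  simp only [gammaMellin]
  rw [← mul_add, ← mul_add, ← mul_add, ← hsum]
  have h2 : (2 : ℂ) ^ (-z) * ((2⁻¹ : ℝ) : ℂ) ^ (-z) = 1 := by
    rw [show (2 : ℂ) = ((2 : ℝ) : ℂ) by simp, ← Complex.mul_cpow_ofReal_nonneg (by norm_num)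
      (by norm_num), ← Complex.ofReal_mul]
    norm_num
  simp only [smul_eq_mul]
  linear_combination (-(Complex.Gamma z)⁻¹ * mellin (barnesKernel a₁ a₂ (2 * w)) z) * h2

/-- Derivative of `zeta₂_two_mul` at $s=0$. The factor $2^{-s}$ contributes $-\log 2$ times the sum
of the four values at 0, which by the same formula equals $\zeta_2(0,2w)$. -/
theorem logGamma₂_two_mul {w : ℂ} (hw : 0 < w.re) :
    logGamma₂ a₁ a₂ (2 * w) = -Real.log 2 * zeta₂ a₁ a₂ (2 * w) 0 +
      (logGamma₂ a₁ a₂ w + logGamma₂ a₁ a₂ (w + a₁ / 2) + logGamma₂ a₁ a₂ (w + a₂ / 2) +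
        logGamma₂ a₁ a₂ (w + a₁ / 2 + a₂ / 2)) := by
  have r1 : 0 < (w + a₁ / 2).re := by simp; positivity
  have r2 : 0 < (w + a₂ / 2).re := by simp; positivity
  have r3 : 0 < (w + a₁ / 2 + a₂ / 2).re := by simp; positivity
  have d := fun {w : ℂ} (hw : 0 < w.re) => (differentiableAt_zeta₂ h₁ h₂ hw).hasDerivAt
  have hp : HasDerivAt (fun s : ℂ => (2 : ℂ) ^ (-s)) (-Real.log 2) 0 := by
    have := (hasDerivAt_neg (0 : ℂ)).const_cpow (c := 2) (Or.inl two_ne_zero)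
    rw [neg_zero, Complex.cpow_zero, one_mul, mul_neg_one] at this
    rw [Complex.ofReal_log (by norm_num)]
    simpa using this
  have hS := hp.mul ((((d hw).add (d r1)).add (d r2)).add (d r3))
  have hev : zeta₂ a₁ a₂ (2 * w) =ᶠ[𝓝 0] ((fun s : ℂ => (2 : ℂ) ^ (-s)) *
      (zeta₂ a₁ a₂ w + zeta₂ a₁ a₂ (w + a₁ / 2) + zeta₂ a₁ a₂ (w + a₂ / 2) +
        zeta₂ a₁ a₂ (w + a₁ / 2 + a₂ / 2))) := by
    filter_upwards [(Set.toFinite {1, 2}).isClosed.isOpen_compl.mem_nhds zero_notMem_pair]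
      with s hs
    exact zeta₂_two_mul h₁ h₂ hw hs
  rw [zeta₂_two_mul h₁ h₂ hw zero_notMem_pair]
  have := (hS.congr_of_eventuallyEq hev).deriv
  rw [logGamma₂, this]
  simp [logGamma₂]

end Kernel

/-! ### Laws and their Mellin transforms -/

/-- `μ` is carried by `S` and has the Mellin transform `φ` on `D`. -/
def MellinOn (S : Set ℝ) (D : Set ℂ) (φ : ℂ → ℂ) (μ : Measure ℝ) : Prop :=
  (∀ᵐ x ∂μ, x ∈ S) ∧
    ∀ q ∈ D, Integrable (fun x : ℝ => (x : ℂ) ^ q) μ ∧ ∫ x : ℝ, (x : ℂ) ^ q ∂μ = φ q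

section MellinOn

variable {S T : Set ℝ} {D : Set ℂ} {φ ψ : ℂ → ℂ} {μ ν : Measure ℝ}

lemma HasMellin.mellinOn (h : HasMellin S D φ μ) : MellinOn S D φ μ := ⟨h.2.1, h.2.2⟩

/-- The Mellin transform at 0 is the total mass, so normalization of `φ` already makes `μ` a
probability law. -/
lemma MellinOn.hasMellin (h : MellinOn S D φ μ) (h0 : 0 ∈ D) (h1 : φ 0 = 1) :
    HasMellin S D φ μ := by
  refine ⟨⟨?_⟩, h.1, h.2⟩
  have h2 := (h.2 0 h0).2
  simp only [Complex.cpow_zero, integral_const, h1] at h2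
  have h3 : μ.real univ = 1 := by
    have := congrArg Complex.re h2
    simpa using this
  rw [measureReal_def, ENNReal.toReal_eq_one_iff] at h3
  exact h3

lemma MellinOn.mono {D' : Set ℂ} (h : MellinOn S D φ μ) (hST : S ⊆ T) (hD : D' ⊆ D)
    (hφ : ∀ q ∈ D', φ q = ψ q) : MellinOn T D' ψ μ :=
  ⟨h.1.mono fun _ hx => hST hx, fun q hq => by rw [← hφ q hq]; exact h.2 q (hD hq)⟩

lemma measurable_ofReal_cpow (q : ℂ) : Measurable fun x : ℝ => (x : ℂ) ^ q := by fun_prop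

lemma MellinOn.map (h : MellinOn S D φ μ) {f : ℝ → ℝ} {g : ℂ → ℂ} (hf : Measurable f)
    (hT : MeasurableSet T) (hST : ∀ x ∈ S, f x ∈ T)
    (hp : ∀ x ∈ S, ∀ q, (f x : ℂ) ^ q = (x : ℂ) ^ g q) :
    MellinOn T (g ⁻¹' D) (fun q => φ (g q)) (μ.map f) := by
  refine ⟨(ae_map_iff hf.aemeasurable hT).2 (h.1.mono hST), fun q hq => ?_⟩
  have he : (fun x : ℝ => (x : ℂ) ^ q) ∘ f =ᵐ[μ] fun x : ℝ => (x : ℂ) ^ g q :=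
    h.1.mono fun x hx => hp x hx q
  rw [integrable_map_measure (measurable_ofReal_cpow q).aestronglyMeasurable hf.aemeasurable,
    integral_map hf.aemeasurable (measurable_ofReal_cpow q).aestronglyMeasurable,
    integrable_congr he]
  exact ⟨(h.2 _ hq).1, (integral_congr_ae he).trans (h.2 _ hq).2⟩

lemma MellinOn.inv (h : MellinOn S D φ μ) (hS : S ⊆ Ioi 0) :
    MellinOn (Ioi 0) (Neg.neg ⁻¹' D) (fun q => φ (-q)) (μ.map fun x => x⁻¹) :=
  h.map measurable_inv measurableSet_Ioi (fun x hx => mem_Ioi.2 (inv_pos.2 (hS hx))) fun x hx q => by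
    rw [Complex.ofReal_inv, Complex.inv_cpow, Complex.cpow_neg]
    rw [Complex.arg_ofReal_of_nonneg (le_of_lt (hS hx))]
    exact Real.pi_pos.ne

lemma MellinOn.powLaw (h : MellinOn S D φ μ) (hS : S ⊆ Ioi 0) {r : ℝ} (hT : MeasurableSet T)
    (hST : ∀ x ∈ S, x ^ r ∈ T) :
    MellinOn T ((fun q => (r : ℂ) * q) ⁻¹' D) (fun q => φ (r * q)) (powLaw μ r) :=
  h.map (by fun_prop) hT hST fun x hx q => by
    rw [← Complex.cpow_mul_ofReal_nonneg (le_of_lt (hS hx)) r q]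

/-- Stated for a general multiplicative `F` so that it applies both to $x^q$ and to its norm; the
latter supplies absolute convergence for compound Poisson laws. -/
lemma integral_mconv_of_multiplicative {𝕜 : Type*} [RCLike 𝕜] {F : ℝ → 𝕜} [SFinite μ] [SFinite ν]
    (hF : Measurable F) (hmul : ∀ x y, 0 < x → 0 < y → F (x * y) = F x * F y)
    (hμ : ∀ᵐ x ∂μ, 0 < x) (hν : ∀ᵐ x ∂ν, 0 < x) (hiμ : Integrable F μ) (hiν : Integrable F ν) :
    Integrable F (μ.mconv ν) ∧ ∫ x, F x ∂(μ.mconv ν) = (∫ x, F x ∂μ) * ∫ x, F x ∂ν := by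
  have he : (F ∘ fun p : ℝ × ℝ => p.1 * p.2) =ᵐ[μ.prod ν] fun p => F p.1 * F p.2 := by
    filter_upwards [Measure.quasiMeasurePreserving_fst.ae hμ,
      Measure.quasiMeasurePreserving_snd.ae hν] with p h1 h2
    exact hmul _ _ h1 h2
  have hm : Measurable fun p : ℝ × ℝ => p.1 * p.2 := by fun_prop
  rw [Measure.mconv, integrable_map_measure hF.aestronglyMeasurable hm.aemeasurable,
    integral_map hm.aemeasurable hF.aestronglyMeasurable, integrable_congr he,
    ← integral_prod_mul]
  exact ⟨hiμ.mul_prod hiν, integral_congr_ae he⟩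

lemma ae_mem_mconv [SFinite μ] [SFinite ν] (hS : MeasurableSet S)
    (hmul : ∀ x ∈ S, ∀ y ∈ S, x * y ∈ S) (hμ : ∀ᵐ x ∂μ, x ∈ S) (hν : ∀ᵐ x ∂ν, x ∈ S) :
    ∀ᵐ x ∂(μ.mconv ν), x ∈ S := by
  have hm : Measurable fun p : ℝ × ℝ => p.1 * p.2 := by fun_prop
  refine (ae_map_iff hm.aemeasurable hS).2 ?_
  filter_upwards [Measure.quasiMeasurePreserving_fst.ae hμ,
    Measure.quasiMeasurePreserving_snd.ae hν] with p h1 h2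
  exact hmul _ h1 _ h2

lemma ofReal_mul_cpow (q : ℂ) {x y : ℝ} (hx : 0 < x) (hy : 0 < y) :
    ((x * y : ℝ) : ℂ) ^ q = (x : ℂ) ^ q * (y : ℂ) ^ q := by
  rw [Complex.ofReal_mul, Complex.mul_cpow_ofReal_nonneg hx.le hy.le]

lemma MellinOn.mconv [SFinite μ] [SFinite ν] (hμ : MellinOn S D φ μ) (hν : MellinOn S D ψ ν)
    (hS : MeasurableSet S) (hpos : S ⊆ Ioi 0) (hmul : ∀ x ∈ S, ∀ y ∈ S, x * y ∈ S) :
    MellinOn S D (fun q => φ q * ψ q) (μ.mconv ν) := by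
  refine ⟨ae_mem_mconv hS hmul hμ.1 hν.1, fun q hq => ?_⟩
  simp only [← (hμ.2 q hq).2, ← (hν.2 q hq).2]
  exact integral_mconv_of_multiplicative (measurable_ofReal_cpow q)
    (fun x y hx hy => ofReal_mul_cpow q hx hy) (hμ.1.mono fun _ hx => hpos hx)
    (hν.1.mono fun _ hx => hpos hx) (hμ.2 q hq).1 (hν.2 q hq).1

lemma mellinOn_dirac {c : ℝ} (hc : c ∈ S) (hS : MeasurableSet S) (D : Set ℂ) :
    MellinOn S D (fun q => (c : ℂ) ^ q) (Measure.dirac c) :=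
  ⟨(ae_dirac_iff hS).2 hc, fun _ _ => ⟨integrable_dirac (by simp), integral_dirac _ _⟩⟩

/-- A probability law on `(0, ∞)` is determined by its Mellin transform on the imaginary axis. -/
theorem HasMellin.unique (hμ : HasMellin S D φ μ) (hν : HasMellin S D φ ν) (hS : S ⊆ Ioi 0)
    (hD : ∀ t : ℝ, (t : ℂ) * Complex.I ∈ D) : μ = ν := by
  -- Pass to the law of the logarithm, from which `ρ` is recovered by the exponential and whose
  -- characteristic function is the Mellin transform at $it$.
  have key : ∀ {ρ : Measure ℝ}, HasMellin S D φ ρ →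
      ρ = (ρ.map Real.log).map Real.exp ∧
        ∀ t : ℝ, charFun (ρ.map Real.log) t = φ (t * Complex.I) := by
    intro ρ h
    have hpos : ∀ᵐ x ∂ρ, 0 < x := (HasMellin.mellinOn h).1.mono fun x hx => hS hx
    refine ⟨?_, fun t => ?_⟩
    · rw [Measure.map_map Real.measurable_exp Real.measurable_log]
      conv_lhs => rw [← Measure.map_id (μ := ρ)]
      exact Measure.map_congr (hpos.mono fun x hx => (Real.exp_log hx).symm)
    · rw [charFun_apply_real, integral_map Real.measurable_log.aemeasurable
        (Measurable.aestronglyMeasurable (by fun_prop)), ← (h.2.2 _ (hD t)).2]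
      refine integral_congr_ae (hpos.mono fun x hx => ?_)
      simp only
      rw [Complex.cpow_def_of_ne_zero (Complex.ofReal_ne_zero.2 hx.ne'), Complex.ofReal_log hx.le]
      congr 1; ring
  have hpμ := hμ.1
  have hpν := hν.1
  have i1 : IsProbabilityMeasure (μ.map Real.log) :=
    Measure.isProbabilityMeasure_map Real.measurable_log.aemeasurable
  have i2 : IsProbabilityMeasure (ν.map Real.log) :=
    Measure.isProbabilityMeasure_map Real.measurable_log.aemeasurable
  have h : μ.map Real.log = ν.map Real.log :=
    Measure.ext_of_charFun (funext fun t => by rw [(key hμ).2, (key hν).2])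
  rw [(key hμ).1, (key hν).1, h]

/-! ### Convolution powers and compound Poisson laws -/

/-- Multiplicative convolution powers. -/
def mconvPow (ν : Measure ℝ) : ℕ → Measure ℝ
  | 0 => Measure.dirac 1
  | n + 1 => ν.mconv (mconvPow ν n)

instance sfinite_mconvPow [SFinite ν] (n : ℕ) : SFinite (mconvPow ν n) := by
  induction n with
  | zero => rw [mconvPow]; infer_instance
  | succ n ih => rw [mconvPow]; infer_instance

lemma ae_mem_mconvPow [SFinite ν] (hS : MeasurableSet S) (h1 : (1 : ℝ) ∈ S)
    (hmul : ∀ x ∈ S, ∀ y ∈ S, x * y ∈ S) (hν : ∀ᵐ x ∂ν, x ∈ S) (n : ℕ) :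
    ∀ᵐ x ∂(mconvPow ν n), x ∈ S := by
  induction n with
  | zero => exact (ae_dirac_iff hS).2 h1
  | succ n ih => exact ae_mem_mconv hS hmul hν ih

lemma integral_mconvPow {𝕜 : Type*} [RCLike 𝕜] {F : ℝ → 𝕜} [SFinite ν] (hF : Measurable F)
    (h1 : F 1 = 1) (hmul : ∀ x y, 0 < x → 0 < y → F (x * y) = F x * F y)
    (hν : ∀ᵐ x ∂ν, x ∈ Ioi 0) (hi : Integrable F ν) (n : ℕ) :
    Integrable F (mconvPow ν n) ∧ ∫ x, F x ∂(mconvPow ν n) = (∫ x, F x ∂ν) ^ n := by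
  induction n with
  | zero => exact ⟨integrable_dirac (by simp), by simp [mconvPow, h1]⟩
  | succ n ih =>
    have h := integral_mconv_of_multiplicative hF hmul hν
      (ae_mem_mconvPow measurableSet_Ioi (by simp) (fun x hx y hy => mem_Ioi.2 (mul_pos hx hy)) hν n) hi ih.1
    exact ⟨h.1, by rw [mconvPow, h.2, ih.2, pow_succ']⟩

/-- The (multiplicative) compound Poisson law with jump measure `ν`. -/
def compoundPoisson (ν : Measure ℝ) : Measure ℝ :=
  Measure.sum fun n : ℕ =>
    ENNReal.ofReal (Real.exp (-ν.real univ) / n.factorial) • mconvPow ν n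

instance sfinite_compoundPoisson [SFinite ν] : SFinite (compoundPoisson ν) := by
  unfold compoundPoisson; infer_instance

/-- The Mellin transform of a compound Poisson law. -/
theorem MellinOn.compoundPoisson [SFinite ν] (hν : MellinOn S D φ ν)
    (hS : MeasurableSet S) (hpos : S ⊆ Ioi 0) (h1 : (1 : ℝ) ∈ S)
    (hmul : ∀ x ∈ S, ∀ y ∈ S, x * y ∈ S) :
    MellinOn S D (fun q => Complex.exp (φ q - ν.real univ)) (compoundPoisson ν) := by
  have hp : ∀ᵐ x ∂ν, x ∈ Ioi 0 := hν.1.mono fun _ hx => hpos hx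
  refine ⟨?_, fun q hq => ?_⟩
  · refine (Measure.ae_sum_iff' hS).2 fun n => Measure.ae_smul_measure
      (ae_mem_mconvPow hS h1 hmul hν.1 n) _
  have hw : ∀ n : ℕ, 0 ≤ Real.exp (-ν.real univ) / n.factorial := fun n => by positivity
  have hF := integral_mconvPow (measurable_ofReal_cpow q) (by simp)
    (fun x y hx hy => ofReal_mul_cpow q hx hy) hp (hν.2 q hq).1
  -- The same power formula for $|x^q|$ bounds the series of norms by an exponential series, which
  -- justifies integrating term by term.
  have hN := integral_mconvPow (measurable_ofReal_cpow q).norm (by simp)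
    (fun x y hx hy => by rw [ofReal_mul_cpow q hx hy, norm_mul]) hp (hν.2 q hq).1.norm
  have hint : Integrable (fun x : ℝ => (x : ℂ) ^ q) (BarnesSelberg.compoundPoisson ν) := by
    refine integrable_sum_measure (fun n => (hF n).1.smul_measure ENNReal.ofReal_ne_top) ?_
    simp only [integral_smul_measure, (hN _).2, ENNReal.toReal_ofReal (hw _), smul_eq_mul]
    have := (Real.summable_pow_div_factorial (∫ x : ℝ, ‖(x : ℂ) ^ q‖ ∂ν)).mul_left
      (Real.exp (-ν.real univ))
    refine this.congr fun n => by ring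
  refine ⟨hint, ?_⟩
  have hs := hasSum_integral_measure hint
  simp only [integral_smul_measure, (hF _).2, ENNReal.toReal_ofReal (hw _), (hν.2 q hq).2] at hs
  have he : HasSum (fun n : ℕ => (Real.exp (-ν.real univ) / n.factorial) • φ q ^ n)
      (Complex.exp (-ν.real univ) * Complex.exp (φ q)) := by
    have := (NormedSpace.expSeries_div_hasSum_exp (φ q)).mul_left
      (Complex.exp (-ν.real univ))
    rw [← Complex.exp_eq_exp_ℂ] at this
    refine this.congr_fun fun n => ?_
    rw [Complex.real_smul]; push_cast; ring
  refine (hs.unique he).trans ?_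
  rw [← Complex.exp_add]
  congr 1; ring

end MellinOn

/-! ### Gamma integrals with a complex rate -/

lemma integrableOn_cpow_mul_cexp {s w : ℂ} (hs : 0 < s.re) (hw : 0 < w.re) :
    IntegrableOn (fun t : ℝ => (t : ℂ) ^ (s - 1) * Complex.exp (-w * t)) (Ioi 0) := by
  refine mellinConvergent_of_isBigO_rpow_exp (f := fun t : ℝ => Complex.exp (-w * t))
    (b := 0) hw ((Continuous.locallyIntegrable (by fun_prop)).locallyIntegrableOn _) ?_ ?_ hs
  · refine IsBigO.of_bound 1 (Eventually.of_forall fun t => ?_)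
    rw [Complex.norm_exp, Real.norm_of_nonneg (Real.exp_pos _).le]
    simp
  · have : Tendsto (fun t : ℝ => Complex.exp (-w * t)) (𝓝[>] 0) (𝓝 (Complex.exp (-w * (0 : ℝ)))) :=
      (Continuous.tendsto (by fun_prop) _).mono_left nhdsWithin_le_nhds
    simpa using this.isBigO_one ℝ

lemma differentiableAt_integral_cpow_mul_cexp {s w : ℂ} (hs : 0 < s.re) (hw : 0 < w.re) :
    DifferentiableAt ℂ
      (fun w : ℂ => ∫ t : ℝ in Ioi 0, (t : ℂ) ^ (s - 1) * Complex.exp (-w * t)) w := by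
  -- Parameters of the dominating function: differentiating in `w` brings down one power of `t`, and
  -- on `Re z > Re w / 2` the rate is at least half of `Re w`.
  have hs' : 0 < ((s.re : ℂ) + 1).re := by simp; linarith
  have hw' : 0 < ((w.re / 2 : ℝ) : ℂ).re := by rw [Complex.ofReal_re]; linarith
  refine (hasDerivAt_integral_of_dominated_loc_of_deriv_le (𝕜 := ℂ) (μ := volume.restrict (Ioi 0))
    (F := fun (w : ℂ) (t : ℝ) => (t : ℂ) ^ (s - 1) * Complex.exp (-w * t)) (x₀ := w)
    (F' := fun w t => (t : ℂ) ^ (s - 1) * (-t * Complex.exp (-w * t)))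
    (bound := fun t : ℝ => ‖(t : ℂ) ^ ((s.re : ℂ) + 1 - 1) *
      Complex.exp (-((w.re / 2 : ℝ) : ℂ) * t)‖)
    (s := {z : ℂ | w.re / 2 < z.re}) ?_ ?_ (integrableOn_cpow_mul_cexp hs hw) ?_ ?_
    (integrableOn_cpow_mul_cexp hs' hw').norm ?_).2.differentiableAt
  · exact (isOpen_lt continuous_const Complex.continuous_re).mem_nhds
      (show w.re / 2 < w.re by linarith)
  · filter_upwards [(isOpen_lt continuous_const Complex.continuous_re).mem_nhds
      (show (0 : ℝ) < w.re from hw)] with z hz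
    exact (integrableOn_cpow_mul_cexp hs hz).aestronglyMeasurable
  · exact Measurable.aestronglyMeasurable (by fun_prop)
  · refine (ae_restrict_mem measurableSet_Ioi).mono fun t ht z hz => ?_
    have ht0 : (0 : ℝ) < t := ht
    rw [norm_mul, norm_mul, norm_mul, Complex.norm_cpow_eq_rpow_re_of_pos ht0,
      Complex.norm_cpow_eq_rpow_re_of_pos ht0, norm_neg, Complex.norm_real,
      Real.norm_of_nonneg ht0.le, Complex.norm_exp, Complex.norm_exp, ← mul_assoc]
    have e1 : t ^ (s - 1).re * t = t ^ ((s.re : ℂ) + 1 - 1).re := by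
      rw [← Real.rpow_add_one ht0.ne']; congr 1; simp
    rw [e1]
    refine mul_le_mul_of_nonneg_left (Real.exp_le_exp.2 ?_) (by positivity)
    have hz' : w.re / 2 < z.re := hz
    have h1 : (-z * (t : ℂ)).re = -(z.re * t) := by simp
    have h2 : (-((w.re / 2 : ℝ) : ℂ) * (t : ℂ)).re = -(w.re / 2 * t) := by
      rw [← Complex.ofReal_neg, ← Complex.ofReal_mul, Complex.ofReal_re]; ring
    rw [h1, h2]
    nlinarith
  · refine Eventually.of_forall fun t z _ => ?_
    have h1 : HasDerivAt (fun z : ℂ => -z * t) (-t) z := by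
      simpa using (hasDerivAt_id z).neg.mul_const (t : ℂ)
    convert! (h1.cexp).const_mul ((t : ℂ) ^ (s - 1)) using 1
    ring

/-- `∫ t^(s-1) e^(-wt) dt = w^(-s) Γ(s)`. -/
theorem integral_cpow_mul_cexp {s w : ℂ} (hs : 0 < s.re) (hw : 0 < w.re) :
    ∫ t : ℝ in Ioi 0, (t : ℂ) ^ (s - 1) * Complex.exp (-w * t) = w ^ (-s) * Complex.Gamma s := by
  have ho : IsOpen {w : ℂ | 0 < w.re} := isOpen_lt continuous_const Complex.continuous_re
  have hf : AnalyticOnNhd ℂ (fun w : ℂ => ∫ t : ℝ in Ioi 0, (t : ℂ) ^ (s - 1) *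
      Complex.exp (-w * t)) {w : ℂ | 0 < w.re} := DifferentiableOn.analyticOnNhd
    (fun z hz => (differentiableAt_integral_cpow_mul_cexp hs hz).differentiableWithinAt) ho
  have hg : AnalyticOnNhd ℂ (fun w : ℂ => w ^ (-s) * Complex.Gamma s) {w : ℂ | 0 < w.re} := by
    refine DifferentiableOn.analyticOnNhd (fun z hz => ?_) ho
    exact ((differentiableAt_id.cpow_const (Or.inl hz)).mul_const _).differentiableWithinAt
  -- The real-rate formula holds at the positive reals, which accumulate at 1, and the identity
  -- theorem spreads it over the right half-plane.
  refine hf.eqOn_of_preconnected_of_frequently_eq hg (convex_halfSpace_re_gt 0).isPreconnected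
    (z₀ := 1) (by simp) ?_ hw
  have hreal : ∀ r : ℝ, 0 < r → ∫ t : ℝ in Ioi 0, (t : ℂ) ^ (s - 1) * Complex.exp (-(r : ℂ) * t) =
      (r : ℂ) ^ (-s) * Complex.Gamma s := by
    intro r hr
    have := Complex.integral_cpow_mul_exp_neg_mul_Ioi hs hr
    simp only [neg_mul]
    rw [this, one_div, Complex.inv_cpow, Complex.cpow_neg]
    rw [Complex.arg_ofReal_of_nonneg hr.le]
    exact Real.pi_pos.ne
  have hT : Tendsto (fun r : ℝ => (r : ℂ)) (𝓝[≠] 1) (𝓝[≠] 1) := by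
    refine tendsto_nhdsWithin_iff.2 ⟨?_, ?_⟩
    · have := (Complex.continuous_ofReal.tendsto 1).mono_left
        (nhdsWithin_le_nhds (a := (1 : ℝ)) (s := {1}ᶜ))
      simpa using this
    · filter_upwards [self_mem_nhdsWithin] with r hr
      simpa using hr
  refine hT.frequently (Eventually.frequently ?_)
  filter_upwards [nhdsWithin_le_nhds (lt_mem_nhds (zero_lt_one' ℝ))] with r hr
  exact hreal r hr

/-- Frullani's integral with complex rates. -/
theorem integral_cexp_sub_cexp_div {w z : ℂ} (hw : 0 < w.re) (hz : 0 < z.re) :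
    IntegrableOn (fun t : ℝ => (Complex.exp (-w * t) - Complex.exp (-z * t)) / t) (Ioi 0) ∧
      ∫ t : ℝ in Ioi 0, (Complex.exp (-w * t) - Complex.exp (-z * t)) / t =
        Complex.log z - Complex.log w := by
  have hne : ∀ {w : ℂ}, 0 < w.re → w ≠ 0 := by rintro w h rfl; simp at h
  have hd : ∀ {w : ℂ}, 0 < w.re → ∀ s : ℂ,
      HasDerivAt (fun s : ℂ => w ^ (-s)) (w ^ (-s) * Complex.log w * -1) s := fun hw s =>
    (hasDerivAt_neg s).const_cpow (Or.inl (hne hw))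
  have hO : ∀ {w : ℂ}, ∀ a ≤ w.re,
      (fun t : ℝ => Complex.exp (-w * t)) =O[atTop] fun t => Real.exp (-a * t) := by
    intro w a ha
    refine IsBigO.of_bound 1 ?_
    filter_upwards [eventually_ge_atTop 0] with t ht
    rw [Complex.norm_exp, Real.norm_of_nonneg (Real.exp_pos _).le, one_mul]
    refine Real.exp_le_exp.2 ?_
    simp only [Complex.mul_re, Complex.neg_re, Complex.ofReal_re, Complex.ofReal_im, mul_zero,
      sub_zero]
    nlinarith
  -- The normalized Mellin transform of the difference is $w^{-s}-z^{-s}$, which is entire; its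
  -- derivative at 0 is the required difference of logarithms.
  have h := (continuation_deriv_zero (f := fun t : ℝ => Complex.exp (-w * t) - Complex.exp (-z * t))
    (Z := fun s => w ^ (-s) - z ^ (-s)) (a := min w.re z.re) (lt_min hw hz)
    (Continuous.continuousOn (by fun_prop))
    ((hO _ (min_le_left _ _)).sub
      (hO _ (min_le_right _ _))) ?_
    (fun s _ => ((hd hw s).sub (hd hz s)).differentiableAt.differentiableWithinAt) ?_).2
  · refine ⟨h.2, ?_⟩
    rw [← h.1]
    have := ((hd hw 0).sub (hd hz 0)).deriv
    simp only [neg_zero, Complex.cpow_zero] at this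
    change deriv ((fun s : ℂ => w ^ (-s)) - fun s : ℂ => z ^ (-s)) 0 = _ at this
    change deriv ((fun s : ℂ => w ^ (-s)) - fun s : ℂ => z ^ (-s)) 0 = _
    rw [this]; ring
  · have hdiff : DifferentiableAt ℝ (fun t : ℝ => Complex.exp (-w * t) - Complex.exp (-z * t)) 0 := by
      have h1 : ∀ w : ℂ, DifferentiableAt ℝ (fun t : ℝ => Complex.exp (-w * t)) 0 := fun w => by
        have : HasDerivAt (fun z : ℂ => Complex.exp (-w * z)) (Complex.exp (-w * ((0 : ℝ) : ℂ)) *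
            (-w * 1)) ((0 : ℝ) : ℂ) := ((hasDerivAt_id _).const_mul (-w)).cexp
        exact this.comp_ofReal.differentiableAt
      exact (h1 w).sub (h1 z)
    have := hdiff.isBigO_sub
    simp only [Complex.ofReal_zero, mul_zero, sub_self, sub_zero] at this
    exact this.mono nhdsWithin_le_nhds
  · intro s hs
    have hs0 : 0 < s.re := by linarith
    have hG : Complex.Gamma s ≠ 0 := Complex.Gamma_ne_zero_of_re_pos hs0
    simp only [gammaMellin, mellin, smul_eq_mul, mul_sub]
    rw [integral_sub (integrableOn_cpow_mul_cexp hs0 hw) (integrableOn_cpow_mul_cexp hs0 hz),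
      integral_cpow_mul_cexp hs0 hw, integral_cpow_mul_cexp hs0 hz]
    field_simp

/-! ### The Lévy–Khinchine form of `η_{2,2}` -/

/-- `t` times the Lévy density of `-log β_{2,2}(a, b)`. -/
def levyKernel (a₁ a₂ b₀ b₁ b₂ t : ℝ) : ℝ :=
  Real.exp (-b₀ * t) * ((1 - Real.exp (-b₁ * t)) * (1 - Real.exp (-b₂ * t))) /
    ((1 - Real.exp (-a₁ * t)) * (1 - Real.exp (-a₂ * t)))

lemma one_sub_exp_le (b t : ℝ) : 1 - Real.exp (-b * t) ≤ b * t := by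
  have := Real.add_one_le_exp (-b * t)
  linarith

lemma mul_exp_le_one_sub_exp (b t : ℝ) : b * t * Real.exp (-b * t) ≤ 1 - Real.exp (-b * t) := by
  have h := Real.add_one_le_exp (b * t)
  have h2 : Real.exp (b * t) * Real.exp (-b * t) = 1 := by
    rw [← Real.exp_add]; simp
  nlinarith [Real.exp_pos (-b * t)]

lemma inv_one_sub_exp_isBigO {a : ℝ} (ha : 0 < a) :
    (fun t : ℝ => (1 - Real.exp (-a * t))⁻¹) =O[𝓝[>] 0] fun t => t⁻¹ := by
  refine IsBigO.of_bound ((a * Real.exp (-a * 1))⁻¹) ?_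
  filter_upwards [Ioo_mem_nhdsGT (zero_lt_one' ℝ)] with t ht
  have ht0 : 0 < t := ht.1
  have h := mul_exp_le_one_sub_exp a t
  have h2 : Real.exp (-a * 1) ≤ Real.exp (-a * t) := Real.exp_le_exp.2 (by nlinarith [ht.2])
  rw [Real.norm_of_nonneg (inv_nonneg.2 (one_sub_exp_pos ha ht0).le),
    Real.norm_of_nonneg (inv_nonneg.2 ht0.le), ← mul_inv]
  refine inv_anti₀ (by positivity) (le_trans ?_ h)
  have : 0 < a * t := by positivity
  nlinarith

lemma one_sub_exp_isBigO (b : ℝ) : (fun t : ℝ => 1 - Real.exp (-b * t)) =O[𝓝[>] 0] fun t => t := by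
  have hd : DifferentiableAt ℝ (fun t : ℝ => 1 - Real.exp (-b * t)) 0 := by fun_prop
  have := hd.isBigO_sub
  simp only [mul_zero, Real.exp_zero, sub_self, sub_zero] at this
  exact this.mono nhdsWithin_le_nhds

lemma cexp_sub_one_isBigO (q : ℂ) :
    (fun t : ℝ => Complex.exp (-q * t) - 1) =O[𝓝[>] 0] fun t => t := by
  have hd : DifferentiableAt ℝ (fun t : ℝ => Complex.exp (-q * t) - 1) 0 := by
    have : HasDerivAt (fun z : ℂ => Complex.exp (-q * z)) (Complex.exp (-q * ((0 : ℝ) : ℂ)) *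
        (-q * 1)) ((0 : ℝ) : ℂ) := ((hasDerivAt_id _).const_mul (-q)).cexp
    exact this.comp_ofReal.differentiableAt.sub_const 1
  have := hd.isBigO_sub
  simp only [Complex.ofReal_zero, mul_zero, Complex.exp_zero, sub_self, sub_zero] at this
  exact this.mono nhdsWithin_le_nhds

section Levy

variable {a₁ a₂ b₀ b₁ b₂ : ℝ} (h₁ : 0 < a₁) (h₂ : 0 < a₂)

include h₁ h₂

lemma levyKernel_isBigO : levyKernel a₁ a₂ b₀ b₁ b₂ =O[𝓝[>] 0] fun _ => (1 : ℝ) := by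
  have he : (fun t : ℝ => Real.exp (-b₀ * t)) =O[𝓝[>] 0] fun _ => (1 : ℝ) := by
    have : Tendsto (fun t : ℝ => Real.exp (-b₀ * t)) (𝓝[>] 0) (𝓝 (Real.exp (-b₀ * 0))) :=
      (Continuous.tendsto (by fun_prop) _).mono_left nhdsWithin_le_nhds
    exact this.isBigO_one ℝ
  refine ((he.mul ((one_sub_exp_isBigO b₁).mul (one_sub_exp_isBigO b₂))).mul
    ((inv_one_sub_exp_isBigO h₁).mul (inv_one_sub_exp_isBigO h₂))).congr' ?_ ?_
  · exact Eventually.of_forall fun t => by simp only [levyKernel]; rw [div_eq_mul_inv, mul_inv]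
  · filter_upwards [self_mem_nhdsWithin] with t ht
    have : t ≠ 0 := ne_of_gt ht
    field_simp

/-- The kernels of the eight log-gammas combine to $e^{-qt}-1$ times `levyKernel`. The latter is
bounded at 0, so the product is $O(t)$ and `sum_logGamma₂` applies. The bounds on $b_0+b_1$ and
$b_0+b_2$ keep the mixed arguments in the right half-plane. -/
theorem eta₂₂_eq_exp_integral (hb : 0 < min b₀ (b₀ + b₁ + b₂))
    (hb₁ : min b₀ (b₀ + b₁ + b₂) ≤ b₀ + b₁) (hb₂ : min b₀ (b₀ + b₁ + b₂) ≤ b₀ + b₂) {q : ℂ}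
    (hq : -min b₀ (b₀ + b₁ + b₂) < q.re) :
    eta₂₂ a₁ a₂ b₀ b₁ b₂ q = Complex.exp (∫ t : ℝ in Ioi 0,
      (Complex.exp (-q * t) - 1) * (levyKernel a₁ a₂ b₀ b₁ b₂ t : ℂ) / t) := by
  set β := min b₀ (b₀ + b₁ + b₂) with hβ
  have l0 : β ≤ b₀ := min_le_left _ _
  have l3 : β ≤ b₀ + b₁ + b₂ := min_le_right _ _
  let c : Fin 8 → ℂ := ![1, -1, -1, 1, -1, 1, 1, -1]
  let w : Fin 8 → ℂ := ![q + b₀, q + b₀ + b₁, q + b₀ + b₂, q + b₀ + b₁ + b₂,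
    0 + b₀, 0 + b₀ + b₁, 0 + b₀ + b₂, 0 + b₀ + b₁ + b₂]
  have hker : ∀ t : ℝ, ∑ j, c j * barnesKernel a₁ a₂ (w j) t =
      (Complex.exp (-q * t) - 1) * (levyKernel a₁ a₂ b₀ b₁ b₂ t : ℂ) := by
    intro t
    have e : ∀ z u : ℂ, Complex.exp (-(z + u) * t) = Complex.exp (-z * t) * Complex.exp (-u * t) :=
      fun z u => by rw [← Complex.exp_add]; congr 1; ring
    have hs : ∑ j, c j * barnesKernel a₁ a₂ (w j) t = barnesKernel a₁ a₂ (q + b₀) t -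
        barnesKernel a₁ a₂ (q + b₀ + b₁) t - barnesKernel a₁ a₂ (q + b₀ + b₂) t +
        barnesKernel a₁ a₂ (q + b₀ + b₁ + b₂) t - (barnesKernel a₁ a₂ b₀ t -
        barnesKernel a₁ a₂ (b₀ + b₁) t - barnesKernel a₁ a₂ (b₀ + b₂) t +
        barnesKernel a₁ a₂ (b₀ + b₁ + b₂) t) := by
      simp [Fin.sum_univ_eight, c, w]
      ring
    rw [hs]
    simp only [barnesKernel, levyKernel, e]
    push_cast
    ring
  have hO : (fun t => ∑ j, c j * barnesKernel a₁ a₂ (w j) t) =O[𝓝[>] 0] fun t : ℝ => t := by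
    simp only [hker]
    have hl : (fun t => (levyKernel a₁ a₂ b₀ b₁ b₂ t : ℂ)) =O[𝓝[>] 0] fun _ => (1 : ℝ) :=
      IsBigO.of_norm_left (by simpa using (levyKernel_isBigO h₁ h₂).norm_left)
    simpa using (cexp_sub_one_isBigO q).mul hl
  obtain ⟨m, hm, m1, m2⟩ : ∃ m, 0 < m ∧ m ≤ β ∧ m ≤ q.re + β :=
    ⟨min β (q.re + β), lt_min hb (by linarith), min_le_left _ _, min_le_right _ _⟩
  have hw : ∀ j, m ≤ (w j).re := by
    intro j
    fin_cases j <;> simp [w] <;> linarith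
  have h := sum_logGamma₂ h₁ h₂ Finset.univ c w hm hw hO
  simp only [hker] at h
  rw [← h, eta₂₂, S₂, S₂]
  congr 1
  simp only [Fin.sum_univ_eight, c, w]
  simp
  ring

end Levy

/-- Symmetry of `η_{2,2}`. -/
lemma eta₂₂_symm (a₁ a₂ b₀ b₁ b₂ : ℝ) :
    eta₂₂ a₁ a₂ (b₀ + b₁ + b₂) (-b₁) (-b₂) = eta₂₂ a₁ a₂ b₀ b₁ b₂ := by
  ext q
  have e : ∀ q : ℂ, S₂ (logGamma₂ a₁ a₂) (b₀ + b₁ + b₂) (-b₁) (-b₂) q =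
      S₂ (logGamma₂ a₁ a₂) b₀ b₁ b₂ q := by
    intro q
    simp only [S₂]
    push_cast
    rw [show q + ((b₀ : ℂ) + b₁ + b₂) = q + b₀ + b₁ + b₂ by ring,
      show q + (b₀ : ℂ) + b₁ + b₂ + -b₁ = q + b₀ + b₂ by ring,
      show q + (b₀ : ℂ) + b₁ + b₂ + -b₂ = q + b₀ + b₁ by ring,
      show q + (b₀ : ℂ) + b₂ + -b₂ = q + b₀ by ring]
    ring
  simp only [eta₂₂, e]

/-- Scaling of `η_{2,2}` under `τ ↦ 1/τ`. -/
theorem eta₂₂_scaling {τ b₀ b₁ b₂ : ℝ} (hτ : 0 < τ) (hb : 0 < min b₀ (b₀ + b₁ + b₂))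
    (hb₁ : min b₀ (b₀ + b₁ + b₂) ≤ b₀ + b₁) (hb₂ : min b₀ (b₀ + b₁ + b₂) ≤ b₀ + b₂) {q : ℂ}
    (hq : -min b₀ (b₀ + b₁ + b₂) < q.re) :
    eta₂₂ 1 (1 / τ) (b₀ / τ) (b₂ / τ) (b₁ / τ) (q / τ) = eta₂₂ 1 τ b₀ b₁ b₂ q := by
  have hmin : min (b₀ / τ) (b₀ / τ + b₂ / τ + b₁ / τ) = min b₀ (b₀ + b₁ + b₂) / τ := by
    rw [← min_div_div_right hτ.le]; congr 1; ring
  rw [eta₂₂_eq_exp_integral one_pos hτ hb hb₁ hb₂ hq, eta₂₂_eq_exp_integral one_pos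
    (by positivity : 0 < 1 / τ)]
  · congr 1
    -- Substituting $\tau t$ for $t$ preserves $dt/t$ and turns the periods $(1,1/\tau)$ into
    -- $(\tau,1)$; the kernel is symmetric in the periods and in $b_1,b_2$, so both swaps are
    -- harmless.
    have h := integral_comp_mul_left_Ioi (fun t : ℝ => (Complex.exp (-(q / τ) * t) - 1) *
      (levyKernel 1 (1 / τ) (b₀ / τ) (b₂ / τ) (b₁ / τ) t : ℂ) / t) 0 hτ
    rw [mul_zero] at h
    have hτ' : (τ : ℂ) ≠ 0 := Complex.ofReal_ne_zero.2 hτ.ne'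
    rw [eq_inv_smul_iff₀ hτ.ne'] at h
    rw [← h, ← integral_smul]
    refine setIntegral_congr_fun measurableSet_Ioi fun t ht => ?_
    have ht' : (t : ℂ) ≠ 0 := Complex.ofReal_ne_zero.2 (ne_of_gt ht)
    have hl : levyKernel 1 (1 / τ) (b₀ / τ) (b₂ / τ) (b₁ / τ) (τ * t) =
        levyKernel 1 τ b₀ b₁ b₂ t := by
      have e : ∀ b : ℝ, -(b / τ) * (τ * t) = -b * t := fun b => by field_simp
      simp only [levyKernel, e]
      rw [show -1 * (τ * t) = -τ * t by ring, mul_comm (1 - Real.exp (-b₂ * t)),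
        mul_comm (1 - Real.exp (-τ * t))]
    simp only [hl, Complex.real_smul]
    push_cast
    rw [show -(q / τ) * ((τ : ℂ) * t) = -q * t by field_simp]
    field_simp
  · rw [hmin]; positivity
  · rw [hmin, ← add_div]; gcongr
  · rw [hmin, ← add_div]; gcongr
  · rw [hmin, Complex.div_ofReal_re, ← neg_div]; gcongr


/-! ### Existence of the Barnes beta laws -/

/-- The law of `e^(-T)` when `T` has the density `f` on `(0, ∞)`. -/
def expNegLaw (f : ℝ → ℝ) : Measure ℝ :=
  ((volume.restrict (Ioi 0)).withDensity fun t => ENNReal.ofReal (f t)).map fun t => Real.exp (-t)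

instance sfinite_expNegLaw (f : ℝ → ℝ) : SFinite (expNegLaw f) := by
  unfold expNegLaw; infer_instance

lemma integral_withDensity_Ioi {f : ℝ → ℝ} (hf : Measurable f) (h0 : ∀ t, 0 < t → 0 ≤ f t)
    (F : ℝ → ℂ) :
    (Integrable F ((volume.restrict (Ioi 0)).withDensity fun t => ENNReal.ofReal (f t)) ↔
      IntegrableOn (fun t => F t * f t) (Ioi 0)) ∧
    ∫ t, F t ∂((volume.restrict (Ioi 0)).withDensity fun t => ENNReal.ofReal (f t)) =
      ∫ t in Ioi 0, F t * f t := by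
  have he : (fun t => (ENNReal.ofReal (f t)).toReal • F t) =ᵐ[volume.restrict (Ioi 0)]
      fun t => F t * f t :=
    (ae_restrict_mem measurableSet_Ioi).mono fun t ht => by
      simp only [ENNReal.toReal_ofReal (h0 t ht), Complex.real_smul, mul_comm]
  have hfin : ∀ᵐ t ∂(volume.restrict (Ioi (0 : ℝ))), ENNReal.ofReal (f t) < ⊤ :=
    Eventually.of_forall fun t => ENNReal.ofReal_lt_top
  refine ⟨?_, ?_⟩
  · rw [integrable_withDensity_iff_integrable_smul' hf.ennreal_ofReal hfin, integrable_congr he,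
      IntegrableOn]
  · rw [integral_withDensity_eq_integral_toReal_smul hf.ennreal_ofReal hfin, integral_congr_ae he]

lemma ofReal_exp_neg_cpow (t : ℝ) (q : ℂ) :
    ((Real.exp (-t) : ℝ) : ℂ) ^ q = Complex.exp (-q * t) := by
  rw [Complex.cpow_def_of_ne_zero (Complex.ofReal_ne_zero.2 (Real.exp_pos _).ne'),
    ← Complex.ofReal_log (Real.exp_pos _).le, Real.log_exp]
  congr 1; push_cast; ring

lemma mellinOn_expNegLaw {f : ℝ → ℝ} {D : Set ℂ} (hf : Measurable f) (h0 : ∀ t, 0 < t → 0 ≤ f t)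
    (hi : ∀ q ∈ D, IntegrableOn (fun t : ℝ => Complex.exp (-q * t) * f t) (Ioi 0)) :
    MellinOn (Ioc 0 1) D (fun q => ∫ t : ℝ in Ioi 0, Complex.exp (-q * t) * f t)
      (expNegLaw f) := by
  have hm : Measurable fun t : ℝ => Real.exp (-t) := by fun_prop
  refine ⟨(ae_map_iff hm.aemeasurable measurableSet_Ioc).2 ?_, fun q hq => ?_⟩
  · refine (withDensity_absolutelyContinuous _ _).ae_le
      ((ae_restrict_mem measurableSet_Ioi).mono fun t ht => ⟨Real.exp_pos _, ?_⟩)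
    have : (0 : ℝ) < t := ht
    rw [Real.exp_le_one_iff]; linarith
  · rw [expNegLaw, integrable_map_measure (measurable_ofReal_cpow q).aestronglyMeasurable
      hm.aemeasurable, integral_map hm.aemeasurable (measurable_ofReal_cpow q).aestronglyMeasurable]
    simp only [Function.comp_def, ofReal_exp_neg_cpow]
    have := integral_withDensity_Ioi hf h0 fun t : ℝ => Complex.exp (-q * t)
    exact ⟨this.1.2 (hi q hq), this.2⟩

/-- The density of the gamma law with shape `k` and rate `θ`. -/
def gammaDensity (k θ t : ℝ) : ℝ := θ ^ k / Real.Gamma k * (t ^ (k - 1) * Real.exp (-θ * t))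

/-- This is $(\theta/(\theta+q))^k$, written through logarithms so that Frullani's integral later
turns the exponent into an integral against the Lévy density $k e^{-\theta t}/t$. -/
lemma mellinOn_gamma {k θ : ℝ} (hk : 0 < k) (hθ : 0 < θ) :
    MellinOn (Ioc 0 1) {q | -θ < q.re}
      (fun q => Complex.exp (k * (Complex.log θ - Complex.log (q + θ))))
      (expNegLaw (gammaDensity k θ)) := by
  have hk' : 0 < (k : ℂ).re := by simpa
  have hΓ := Real.Gamma_pos_of_pos hk
  have hq' : ∀ q : ℂ, -θ < q.re → 0 < (q + θ).re := fun q hq => by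
    simp only [Complex.add_re, Complex.ofReal_re]; linarith
  have he : ∀ q : ℂ, EqOn (fun t : ℝ => Complex.exp (-q * t) * (gammaDensity k θ t : ℂ))
      (fun t : ℝ => ((θ ^ k / Real.Gamma k : ℝ) : ℂ) * ((t : ℂ) ^ ((k : ℂ) - 1) *
        Complex.exp (-(q + θ) * t))) (Ioi 0) := by
    intro q t ht
    have ht' : (0 : ℝ) < t := ht
    have e1 : ((t ^ (k - 1) : ℝ) : ℂ) = (t : ℂ) ^ ((k : ℂ) - 1) := by
      rw [Complex.ofReal_cpow ht'.le]; push_cast; rfl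
    have e2 : Complex.exp (-(q + θ) * t) = Complex.exp (-q * t) * (Real.exp (-θ * t) : ℝ) := by
      push_cast; rw [← Complex.exp_add]; congr 1; ring
    simp only [gammaDensity]
    rw [Complex.ofReal_mul, Complex.ofReal_mul, e1, e2]
    ring
  refine (mellinOn_expNegLaw (D := {q | -θ < q.re}) ?_ ?_ ?_).mono subset_rfl subset_rfl ?_
  · unfold gammaDensity; fun_prop
  · intro t ht; unfold gammaDensity; positivity
  · intro q hq
    exact IntegrableOn.congr_fun ((integrableOn_cpow_mul_cexp hk' (hq' q hq)).const_mul _)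
      (he q).symm measurableSet_Ioi
  · intro q hq
    have hne : q + θ ≠ 0 := by
      intro h; have := hq' q hq; rw [h] at this; simp at this
    have hθ' : (θ : ℂ) ≠ 0 := Complex.ofReal_ne_zero.2 hθ.ne'
    rw [setIntegral_congr_fun measurableSet_Ioi (he q), integral_const_mul,
      integral_cpow_mul_cexp hk' (hq' q hq), Complex.Gamma_ofReal, Complex.ofReal_div,
      Complex.ofReal_cpow hθ.le, Complex.cpow_def_of_ne_zero hne, Complex.cpow_def_of_ne_zero hθ',
      mul_sub, Complex.exp_sub, mul_neg, Complex.exp_neg]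
    have := Complex.ofReal_ne_zero.2 hΓ.ne'
    rw [mul_comm (Complex.log θ), mul_comm (Complex.log (q + θ))]
    field_simp

/-- The Lévy density of `-log β_{2,2}(a, b)` minus that of a gamma law. -/
def levyRem (a₁ a₂ b₀ b₁ b₂ t : ℝ) : ℝ :=
  (levyKernel a₁ a₂ b₀ b₁ b₂ t -
    b₁ * b₂ / (a₁ * a₂) * Real.exp (-(b₀ + b₁ + b₂) * t)) / t

section Existence

variable {a₁ a₂ b₀ b₁ b₂ : ℝ} (h₁ : 0 < a₁) (h₂ : 0 < a₂) (hb₁ : 0 < b₁) (hb₂ : 0 < b₂)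

include h₁ h₂ hb₁ hb₂

/-- Apply $bt\,e^{-bt}\le 1-e^{-bt}$ in the numerator and $1-e^{-at}\le at$ in the denominator. The
two exponentials lost in the numerator explain the rate $b_0+b_1+b_2$ of the gamma law; its shape
$b_1b_2/(a_1a_2)$ is the limit of `levyKernel` at 0. -/
lemma levyKernel_ge {t : ℝ} (ht : 0 < t) :
    b₁ * b₂ / (a₁ * a₂) * Real.exp (-(b₀ + b₁ + b₂) * t) ≤ levyKernel a₁ a₂ b₀ b₁ b₂ t := by
  have e : Real.exp (-(b₀ + b₁ + b₂) * t) =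
      Real.exp (-b₀ * t) * (Real.exp (-b₁ * t) * Real.exp (-b₂ * t)) := by
    rw [← Real.exp_add, ← Real.exp_add]; congr 1; ring
  have p1 := one_sub_exp_pos h₁ ht
  have p2 := one_sub_exp_pos h₂ ht
  rw [levyKernel, e, le_div_iff₀ (mul_pos p1 p2)]
  calc _ ≤ b₁ * b₂ / (a₁ * a₂) * (Real.exp (-b₀ * t) *
        (Real.exp (-b₁ * t) * Real.exp (-b₂ * t))) * ((a₁ * t) * (a₂ * t)) := by
        gcongr
        · exact one_sub_exp_le a₁ t
        · exact one_sub_exp_le a₂ t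
    _ = Real.exp (-b₀ * t) * ((b₁ * t * Real.exp (-b₁ * t)) * (b₂ * t * Real.exp (-b₂ * t))) := by
        field_simp
    _ ≤ _ := by
        gcongr
        · exact (one_sub_exp_pos hb₁ ht).le
        · exact mul_exp_le_one_sub_exp b₁ t
        · exact mul_exp_le_one_sub_exp b₂ t

/-- Together with `levyKernel_ge` this squeezes the kernel to first order at 0, so that `levyRem`
stays bounded there despite the division by `t`. -/
lemma levyKernel_le {t : ℝ} (ht : 0 < t) :
    levyKernel a₁ a₂ b₀ b₁ b₂ t ≤ b₁ * b₂ / (a₁ * a₂) * Real.exp ((a₁ + a₂ - b₀) * t) := by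
  have p1 := one_sub_exp_pos h₁ ht
  have p2 := one_sub_exp_pos h₂ ht
  rw [levyKernel, div_le_iff₀ (mul_pos p1 p2)]
  have e : Real.exp ((a₁ + a₂ - b₀) * t) * (Real.exp (-a₁ * t) * Real.exp (-a₂ * t)) =
      Real.exp (-b₀ * t) := by
    rw [← Real.exp_add, ← Real.exp_add]; congr 1; ring
  calc _ ≤ Real.exp (-b₀ * t) * ((b₁ * t) * (b₂ * t)) := by
        gcongr
        · exact (one_sub_exp_pos hb₂ ht).le
        · exact one_sub_exp_le b₁ t
        · exact one_sub_exp_le b₂ t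
    _ = b₁ * b₂ / (a₁ * a₂) * Real.exp ((a₁ + a₂ - b₀) * t) *
        ((a₁ * t * Real.exp (-a₁ * t)) * (a₂ * t * Real.exp (-a₂ * t))) := by
        rw [← e]; field_simp
    _ ≤ _ := by
        gcongr
        · exact mul_exp_le_one_sub_exp a₁ t
        · exact mul_exp_le_one_sub_exp a₂ t

lemma levyRem_nonneg {t : ℝ} (ht : 0 < t) : 0 ≤ levyRem a₁ a₂ b₀ b₁ b₂ t :=
  div_nonneg (sub_nonneg.2 (levyKernel_ge h₁ h₂ hb₁ hb₂ ht)) ht.le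

lemma levyRem_isBigO_zero : levyRem a₁ a₂ b₀ b₁ b₂ =O[𝓝[>] 0] fun _ => (1 : ℝ) := by
  have hd : DifferentiableAt ℝ (fun t : ℝ => b₁ * b₂ / (a₁ * a₂) *
      Real.exp ((a₁ + a₂ - b₀) * t) - b₁ * b₂ / (a₁ * a₂) * Real.exp (-(b₀ + b₁ + b₂) * t)) 0 := by
    fun_prop
  have hO := hd.isBigO_sub
  simp only [mul_zero, Real.exp_zero, sub_self, sub_zero] at hO
  have hO2 := (hO.mono nhdsWithin_le_nhds).mul (isBigO_refl (fun t : ℝ => t⁻¹) (𝓝[>] 0))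
  refine IsBigO.trans (IsBigO.of_bound 1 ?_) (hO2.congr' EventuallyEq.rfl ?_)
  · filter_upwards [self_mem_nhdsWithin] with t ht
    have ht0 : 0 < t := ht
    rw [one_mul, Real.norm_of_nonneg (levyRem_nonneg h₁ h₂ hb₁ hb₂ ht0)]
    refine le_trans ?_ (le_abs_self _)
    rw [levyRem, div_eq_mul_inv]
    have := levyKernel_le (b₀ := b₀) h₁ h₂ hb₁ hb₂ ht0
    gcongr
  · filter_upwards [self_mem_nhdsWithin] with t ht
    exact mul_inv_cancel₀ (ne_of_gt ht)

lemma levyRem_isBigO_top :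
    levyRem a₁ a₂ b₀ b₁ b₂ =O[atTop] fun t => Real.exp (-b₀ * t) := by
  refine IsBigO.of_bound (((1 - Real.exp (-a₁ * 1)) * (1 - Real.exp (-a₂ * 1)))⁻¹) ?_
  filter_upwards [eventually_ge_atTop 1] with t ht
  have ht0 : 0 < t := by linarith
  have e1 := one_sub_exp_pos h₁ one_pos
  have e2 := one_sub_exp_pos h₂ one_pos
  have m1 : Real.exp (-a₁ * t) ≤ Real.exp (-a₁ * 1) := Real.exp_le_exp.2 (by nlinarith)
  have m2 : Real.exp (-a₂ * t) ≤ Real.exp (-a₂ * 1) := Real.exp_le_exp.2 (by nlinarith)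
  have q1 := one_sub_exp_pos h₁ ht0
  have q2 := one_sub_exp_pos h₂ ht0
  have r1 := one_sub_exp_pos hb₁ ht0
  have r2 := one_sub_exp_pos hb₂ ht0
  have s1 := Real.exp_pos (-b₁ * t)
  have s2 := Real.exp_pos (-b₂ * t)
  rw [Real.norm_of_nonneg (levyRem_nonneg h₁ h₂ hb₁ hb₂ ht0),
    Real.norm_of_nonneg (Real.exp_pos _).le]
  calc levyRem a₁ a₂ b₀ b₁ b₂ t ≤ levyKernel a₁ a₂ b₀ b₁ b₂ t / t := by
        rw [levyRem]
        gcongr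
        have : 0 < b₁ * b₂ / (a₁ * a₂) * Real.exp (-(b₀ + b₁ + b₂) * t) := by positivity
        linarith
    _ ≤ levyKernel a₁ a₂ b₀ b₁ b₂ t := by
        refine div_le_self ?_ ht
        unfold levyKernel; positivity
    _ ≤ Real.exp (-b₀ * t) * (1 * 1) /
        ((1 - Real.exp (-a₁ * 1)) * (1 - Real.exp (-a₂ * 1))) := by
        rw [levyKernel]
        gcongr
        · linarith
        · linarith
    _ = _ := by rw [mul_one, mul_one, div_eq_inv_mul]

omit hb₁ hb₂ in
lemma continuousOn_levyRem : ContinuousOn (levyRem a₁ a₂ b₀ b₁ b₂) (Ioi 0) := by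
  unfold levyRem levyKernel
  refine ContinuousOn.div (ContinuousOn.sub (ContinuousOn.div (by fun_prop) (by fun_prop)
    fun t ht => ?_) (by fun_prop)) (by fun_prop) fun t ht => ne_of_gt ht
  exact (mul_pos (one_sub_exp_pos h₁ ht) (one_sub_exp_pos h₂ ht)).ne'

lemma integrableOn_levyRem {q : ℂ} (hq : -b₀ < q.re) :
    IntegrableOn (fun t : ℝ => Complex.exp (-q * t) * (levyRem a₁ a₂ b₀ b₁ b₂ t : ℂ))
      (Ioi 0) := by
  have hn : ∀ t : ℝ, ‖Complex.exp (-q * t)‖ = Real.exp (-q.re * t) := fun t => by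
    rw [Complex.norm_exp]; simp
  have h := mellinConvergent_of_isBigO_rpow_exp (a := q.re + b₀) (b := 0) (s := 1)
    (f := fun t : ℝ => Complex.exp (-q * t) * (levyRem a₁ a₂ b₀ b₁ b₂ t : ℂ)) (by linarith)
    (ContinuousOn.locallyIntegrableOn (ContinuousOn.mul (by fun_prop)
      (Complex.continuous_ofReal.comp_continuousOn
        (continuousOn_levyRem h₁ h₂))) measurableSet_Ioi) ?_ ?_ (by simp)
  · simpa [MellinConvergent] using h
  · refine IsBigO.of_norm_left ?_
    simp only [norm_mul, hn, Complex.norm_real]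
    have := (isBigO_refl (fun t : ℝ => Real.exp (-q.re * t)) atTop).mul
      (levyRem_isBigO_top (b₀ := b₀) h₁ h₂ hb₁ hb₂).norm_left
    refine this.congr_right fun t => ?_
    rw [← Real.exp_add]; congr 1; ring
  · refine IsBigO.of_norm_left ?_
    simp only [norm_mul, hn, Complex.norm_real]
    have hE : (fun t : ℝ => Real.exp (-q.re * t)) =O[𝓝[>] 0] fun _ => (1 : ℝ) := by
      have : Tendsto (fun t : ℝ => Real.exp (-q.re * t)) (𝓝[>] 0) (𝓝 (Real.exp (-q.re * 0))) :=
        (Continuous.tendsto (by fun_prop) _).mono_left nhdsWithin_le_nhds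
      exact this.isBigO_one ℝ
    simpa using hE.mul (levyRem_isBigO_zero (b₀ := b₀) h₁ h₂ hb₁ hb₂).norm_left

/-- A Barnes beta law with positive parameters is a gamma law convolved with a compound Poisson
law. -/
theorem exists_isBarnesBeta₂₂_of_pos (hb₀ : 0 < b₀) :
    ∃ μ, IsBarnesBeta₂₂ a₁ a₂ b₀ b₁ b₂ μ := by
  set k := b₁ * b₂ / (a₁ * a₂) with hk
  set θ := b₀ + b₁ + b₂ with hθ
  have hk0 : 0 < k := by positivity
  have hθ0 : 0 < θ := by positivity
  have hmin : min b₀ (b₀ + b₁ + b₂) = b₀ := min_eq_left (by linarith)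
  have hmul : ∀ x ∈ Ioc (0 : ℝ) 1, ∀ y ∈ Ioc (0 : ℝ) 1, x * y ∈ Ioc (0 : ℝ) 1 :=
    fun x hx y hy => ⟨mul_pos hx.1 hy.1, mul_le_one₀ hx.2 hy.1.le hy.2⟩
  have hpos : Ioc (0 : ℝ) 1 ⊆ Ioi 0 := fun x hx => hx.1
  let D : Set ℂ := {q | -b₀ < q.re}
  have hν : MellinOn (Ioc 0 1) D _ (expNegLaw (levyRem a₁ a₂ b₀ b₁ b₂)) :=
    mellinOn_expNegLaw (by unfold levyRem levyKernel; fun_prop)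
      (fun t ht => levyRem_nonneg h₁ h₂ hb₁ hb₂ ht)
      fun q hq => integrableOn_levyRem h₁ h₂ hb₁ hb₂ hq
  have h0 : (0 : ℂ) ∈ D := by simp only [D, mem_ofPred_eq, Complex.zero_re]; linarith
  have hmass : ((expNegLaw (levyRem a₁ a₂ b₀ b₁ b₂)).real univ : ℂ) =
      ∫ t : ℝ in Ioi 0, Complex.exp (-0 * t) * (levyRem a₁ a₂ b₀ b₁ b₂ t : ℂ) := by
    refine Eq.trans ?_ (hν.2 0 h0).2
    simp
  have hγ : MellinOn (Ioc 0 1) D _ (expNegLaw (gammaDensity k θ)) :=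
    (mellinOn_gamma hk0 hθ0).mono (ψ := _) subset_rfl
      (fun q (hq : -b₀ < q.re) => show -θ < q.re by linarith) fun q _ => rfl
  have hprod := hγ.mconv (hν.compoundPoisson measurableSet_Ioc hpos (by simp) hmul)
    measurableSet_Ioc hpos hmul
  refine ⟨_, ((hprod.mono subset_rfl (D' := {q | -min b₀ (b₀ + b₁ + b₂) < q.re})
    (ψ := eta₂₂ a₁ a₂ b₀ b₁ b₂) ?_ ?_).hasMellin ?_ ?_)⟩
  · rw [hmin]
  · intro q hq
    rw [eta₂₂_eq_exp_integral h₁ h₂ (by rw [hmin]; exact hb₀) (by rw [hmin]; linarith)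
      (by rw [hmin]; linarith) hq]
    rw [hmin] at hq
    have hq' : -b₀ < q.re := hq
    have hwq : 0 < (q + θ).re := by
      simp only [Complex.add_re, Complex.ofReal_re]; linarith
    -- Frullani's integral writes the gamma exponent as an integral, which merges with the compound
    -- Poisson exponent to restore the full Lévy kernel.
    have hF := integral_cexp_sub_cexp_div (w := q + θ) (z := θ) hwq (by simpa using hθ0)
    have hI : IntegrableOn (fun t : ℝ => Complex.exp (-q * t) * (levyRem a₁ a₂ b₀ b₁ b₂ t : ℂ) -
        Complex.exp (-0 * t) * (levyRem a₁ a₂ b₀ b₁ b₂ t : ℂ)) (Ioi 0) :=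
      (integrableOn_levyRem h₁ h₂ hb₁ hb₂ hq').sub (integrableOn_levyRem h₁ h₂ hb₁ hb₂ h0)
    rw [← hF.2, hmass, ← integral_sub (integrableOn_levyRem h₁ h₂ hb₁ hb₂ hq')
      (integrableOn_levyRem h₁ h₂ hb₁ hb₂ h0), ← Complex.exp_add, ← integral_const_mul,
      ← integral_add (hF.1.const_mul _) hI]
    congr 1
    refine setIntegral_congr_fun measurableSet_Ioi fun t ht => ?_
    have ht' : (t : ℂ) ≠ 0 := Complex.ofReal_ne_zero.2 (ne_of_gt ht)
    have e : Complex.exp (-(q + θ) * t) = Complex.exp (-q * t) * Complex.exp (-θ * t) := by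
      rw [← Complex.exp_add]; congr 1; ring
    simp only [levyRem, e, ← hk, ← hθ]
    push_cast
    rw [neg_zero, zero_mul, Complex.exp_zero]
    field_simp
    ring
  · simp only [mem_ofPred_eq, Complex.zero_re, hmin]; linarith
  · simp [eta₂₂]

end Existence

lemma HasMellin.congr {S : Set ℝ} {D : Set ℂ} {φ ψ : ℂ → ℂ} {μ : Measure ℝ}
    (h : HasMellin S D φ μ) (hφ : ∀ q ∈ D, φ q = ψ q) : HasMellin S D ψ μ :=
  ⟨h.1, h.2.1, fun q hq => by rw [← hφ q hq]; exact h.2.2 q hq⟩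

lemma isBarnesBeta₂₂_symm {a₁ a₂ b₀ b₁ b₂ : ℝ} {μ : Measure ℝ}
    (h : IsBarnesBeta₂₂ a₁ a₂ (b₀ + b₁ + b₂) (-b₁) (-b₂) μ) : IsBarnesBeta₂₂ a₁ a₂ b₀ b₁ b₂ μ := by
  rw [IsBarnesBeta₂₂, eta₂₂_symm, min_comm,
    show b₀ + b₁ + b₂ + -b₁ + -b₂ = b₀ by ring] at h
  exact h

/-- Existence of the Barnes beta law with equal parameters `b₁ = b₂` of either sign. -/
theorem exists_isBarnesBeta₂₂_of_eq {a₁ a₂ b₀ b : ℝ} (h₁ : 0 < a₁) (h₂ : 0 < a₂) (hb₀ : 0 < b₀)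
    (hb : 0 < b₀ + b + b) : ∃ μ, IsBarnesBeta₂₂ a₁ a₂ b₀ b b μ := by
  -- A negative `b` is flipped by the symmetry of $\eta_{2,2}$, with new base $b_0+2b>0$; for $b=0$
  -- the transform is identically 1 and the law is the point mass at 1.
  rcases lt_trichotomy b 0 with h | rfl | h
  · obtain ⟨μ, hμ⟩ := exists_isBarnesBeta₂₂_of_pos h₁ h₂ (neg_pos.2 h) (neg_pos.2 h) hb
    exact ⟨μ, isBarnesBeta₂₂_symm hμ⟩
  · refine ⟨Measure.dirac 1, ((mellinOn_dirac (by simp) measurableSet_Ioc _).mono subset_rfl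
      subset_rfl fun q hq => ?_).hasMellin ?_ ?_⟩
    · simp [eta₂₂, S₂]
    · simpa using hb₀
    · simp [eta₂₂]
  · exact exists_isBarnesBeta₂₂_of_pos h₁ h₂ h h hb₀

/-! ### The lognormal and the Fréchet laws -/

lemma ofReal_exp_cpow (t : ℝ) (q : ℂ) : ((Real.exp t : ℝ) : ℂ) ^ q = Complex.exp (q * t) := by
  simpa using ofReal_exp_neg_cpow (-t) q

theorem mellinOn_lawL {τ : ℝ} (hτ : 0 < τ) :
    MellinOn (Ioi 0) univ (fun q => Complex.exp (2 * Real.log 2 / τ * q ^ 2)) (lawL τ) := by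
  have hm := Real.measurable_exp
  refine ⟨(ae_map_iff hm.aemeasurable measurableSet_Ioi).2
    (Eventually.of_forall fun x => Real.exp_pos x), fun q _ => ?_⟩
  rw [lawL, integrable_map_measure (measurable_ofReal_cpow q).aestronglyMeasurable
    hm.aemeasurable, integral_map hm.aemeasurable (measurable_ofReal_cpow q).aestronglyMeasurable]
  simp only [Function.comp_def, ofReal_exp_cpow]
  refine ⟨integrable_cexp_mul_of_re_mem_integrableExpSet (X := id) aemeasurable_id
    (by rw [integrableExpSet_id_gaussianReal]; trivial), ?_⟩
  have h := complexMGF_id_gaussianReal (μ := 0) (v := Real.toNNReal (4 * Real.log 2 / τ)) q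
  rw [complexMGF] at h
  refine h.trans ?_
  have hv : (((Real.toNNReal (4 * Real.log 2 / τ) : NNReal) : ℝ)) = 4 * Real.log 2 / τ :=
    Real.coe_toNNReal _ (by have := Real.log_pos one_lt_two; positivity)
  congr 1
  rw [hv]
  push_cast
  ring

/-- The substitution $u=y^{-\tau}$ turns the integral into Euler's gamma integral, convergent when
$\Re(1-q/\tau)>0$. -/
theorem mellinOn_lawY {τ : ℝ} (hτ : 0 < τ) :
    MellinOn (Ioi 0) {q | q.re < τ} (fun q => Complex.Gamma (1 - q / τ)) (lawY τ) := by
  refine ⟨(withDensity_absolutelyContinuous _ _).ae_le (ae_restrict_mem measurableSet_Ioi),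
    fun q hq => ?_⟩
  have hq' : q.re < τ := hq
  have hre : 0 < (1 - q / τ).re := by
    rw [Complex.sub_re, Complex.div_ofReal_re, Complex.one_re, sub_pos, div_lt_one hτ]
    exact hq'
  have hd := integral_withDensity_Ioi
    (f := fun y : ℝ => τ * y ^ (-1 - τ) * Real.exp (-(y ^ (-τ)))) (by fun_prop)
    (fun t ht => by positivity) fun x : ℝ => (x : ℂ) ^ q
  have he : EqOn (fun x : ℝ => (|-τ| * x ^ (-τ - 1)) •
      ((Real.exp (-(x ^ (-τ))) : ℂ) * ((x ^ (-τ) : ℝ) : ℂ) ^ (1 - q / τ - 1)))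
      (fun x : ℝ => (x : ℂ) ^ q * ((τ * x ^ (-1 - τ) * Real.exp (-(x ^ (-τ))) : ℝ) : ℂ))
      (Ioi 0) := by
    intro x hx
    have hx0 : (0 : ℝ) < x := hx
    have hτ' : (τ : ℂ) ≠ 0 := Complex.ofReal_ne_zero.2 hτ.ne'
    have e1 : ((x ^ (-τ) : ℝ) : ℂ) ^ (1 - q / τ - 1) = (x : ℂ) ^ q := by
      rw [← Complex.cpow_mul_ofReal_nonneg hx0.le]
      congr 1; push_cast; field_simp; ring
    simp only [e1, Complex.real_smul, abs_neg, abs_of_pos hτ]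
    rw [show -τ - 1 = -1 - τ by ring, Complex.ofReal_mul (τ * x ^ (-1 - τ))]
    ring
  have hG := Complex.GammaIntegral_convergent hre
  have hI := (integrableOn_Ioi_comp_rpow_iff (fun x : ℝ => (Real.exp (-x) : ℂ) *
    (x : ℂ) ^ (1 - q / τ - 1)) (neg_ne_zero.2 hτ.ne')).2 hG
  rw [lawY, hd.1, hd.2, ← setIntegral_congr_fun measurableSet_Ioi he,
    integral_comp_rpow_Ioi (fun x : ℝ => (Real.exp (-x) : ℂ) *
    (x : ℂ) ^ (1 - q / τ - 1)) (neg_ne_zero.2 hτ.ne')]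
  exact ⟨hI.congr_fun he measurableSet_Ioi, (Complex.Gamma_eq_integral hre).symm⟩

/-! ### The factors `X₁, X₂, X₃` -/

/-- The abscissa of convergence of the Mellin transform of `X_{i+1}`. -/
def absX (i : Fin 3) (τ l₁ l₂ : ℝ) : ℝ :=
  min (bpar τ l₁ l₂ i).1 ((bpar τ l₁ l₂ i).1 + (bpar τ l₁ l₂ i).2.1 + (bpar τ l₁ l₂ i).2.2)

lemma re_ofReal_mul_I (t : ℝ) : ((t : ℂ) * Complex.I).re = 0 := by simp

section Factors

variable {τ l₁ l₂ : ℝ} (hτ : 0 < τ) (h₁ : 0 < xpar τ l₁) (h₂ : 0 < xpar τ l₂)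

include hτ h₁ h₂

/-- These are the hypotheses of `eta₂₂_eq_exp_integral`. For $X_1,X_3$ one has $b_1=b_2$, and
$b_0+b_1$ is the midpoint of $b_0$ and $b_0+b_1+b_2$; for $X_2$ both increments are positive. -/
lemma absX_pos (i : Fin 3) : 0 < absX i τ l₁ l₂ ∧
    absX i τ l₁ l₂ ≤ (bpar τ l₁ l₂ i).1 + (bpar τ l₁ l₂ i).2.1 ∧
    absX i τ l₁ l₂ ≤ (bpar τ l₁ l₂ i).1 + (bpar τ l₁ l₂ i).2.2 := by
  have key : ∀ b₀ b₁ b₂ : ℝ, 0 < b₀ → 0 < b₀ + b₁ + b₂ → (b₁ = b₂ ∨ (0 < b₁ ∧ 0 < b₂)) →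
      0 < min b₀ (b₀ + b₁ + b₂) ∧ min b₀ (b₀ + b₁ + b₂) ≤ b₀ + b₁ ∧
        min b₀ (b₀ + b₁ + b₂) ≤ b₀ + b₂ := by
    intro b₀ b₁ b₂ h0 h3 h
    refine ⟨lt_min h0 h3, ?_⟩
    rcases h with rfl | ⟨p1, p2⟩
    · rw [and_self]
      rcases le_total 0 b₁ with h | h
      · exact (min_le_left _ _).trans (by linarith)
      · exact (min_le_right _ _).trans (by linarith)
    · exact ⟨(min_le_left _ _).trans (by linarith), (min_le_left _ _).trans (by linarith)⟩
  fin_cases i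
  · exact key _ _ _ h₁ (by simp only [bpar]; linarith) (Or.inl rfl)
  · exact key _ _ _ (by simp only [bpar]; linarith) (by simp only [bpar]; linarith)
      (Or.inr ⟨by simp only [bpar]; norm_num, by simp only [bpar]; linarith⟩)
  · exact key _ _ _ (by simp only [bpar]; linarith) (by simp only [bpar]; linarith) (Or.inl rfl)

omit h₁ in
lemma le_absX (i : Fin 3) {r : ℝ} (hr₁ : r < xpar τ l₁) (hr₂ : r < xpar τ l₂) (hr : r < 1 + τ) :
    r < absX i τ l₁ l₂ := by
  refine lt_min ?_ ?_ <;> fin_cases i <;> simp only [bpar] <;> linarith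

theorem existsUnique_isBarnesBeta₂₂ (i : Fin 3) : ∃! μ : Measure ℝ, IsBarnesBeta₂₂ 1 τ
    (bpar τ l₁ l₂ i).1 (bpar τ l₁ l₂ i).2.1 (bpar τ l₁ l₂ i).2.2 μ := by
  have hex : ∃ μ : Measure ℝ, IsBarnesBeta₂₂ 1 τ
      (bpar τ l₁ l₂ i).1 (bpar τ l₁ l₂ i).2.1 (bpar τ l₁ l₂ i).2.2 μ := by
    fin_cases i
    · exact exists_isBarnesBeta₂₂_of_eq one_pos hτ h₁ (by simp only [bpar]; linarith)
    · exact exists_isBarnesBeta₂₂_of_pos one_pos hτ (by simp only [bpar]; norm_num)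
        (by simp only [bpar]; linarith) (by simp only [bpar]; linarith)
    · exact exists_isBarnesBeta₂₂_of_eq one_pos hτ (by simp only [bpar]; linarith)
        (by simp only [bpar]; linarith)
  obtain ⟨μ, hμ⟩ := hex
  refine ⟨μ, hμ, fun ν hν => HasMellin.unique hν hμ (fun x hx => hx.1) fun t => ?_⟩
  have := (absX_pos hτ h₁ h₂ i).1
  rw [absX] at this
  simp only [mem_ofPred_eq, re_ofReal_mul_I]
  linarith

theorem hasMellin_lawX (i : Fin 3) : HasMellin (Ioi 0) {q | q.re < absX i τ l₁ l₂}
    (fun q => eta₂₂ 1 τ (bpar τ l₁ l₂ i).1 (bpar τ l₁ l₂ i).2.1 (bpar τ l₁ l₂ i).2.2 (-q))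
    (lawX i τ l₁ l₂) := by
  have h : IsBarnesBeta₂₂ 1 τ (bpar τ l₁ l₂ i).1 (bpar τ l₁ l₂ i).2.1 (bpar τ l₁ l₂ i).2.2 _ :=
    Classical.epsilon_spec (existsUnique_isBarnesBeta₂₂ hτ h₁ h₂ i).exists
  have hM := (HasMellin.mellinOn h).inv fun x hx => hx.1
  refine MellinOn.hasMellin (hM.mono subset_rfl (fun q hq => ?_) fun q _ => rfl) ?_ ?_
  · have hq' : q.re < absX i τ l₁ l₂ := hq
    show -absX i τ l₁ l₂ < (-q).re
    rw [Complex.neg_re]; linarith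
  · exact (absX_pos hτ h₁ h₂ i).1
  · simp [eta₂₂]

/-- The Mellin transform of `M_(a,x)` factors into those of a constant, of `L`, and of the `X_i`. -/
theorem mellinM_eq {q : ℂ} (hq₁ : q.re < xpar τ l₁) (hq₂ : q.re < xpar τ l₂) :
    mellinM 1 τ (xpar τ l₁) (xpar τ l₂) q =
      (((2 : ℝ) ^ (-(3 * (1 + τ) + 2 * τ * (l₁ + l₂)) / τ) : ℝ) : ℂ) ^ q *
      (Complex.exp (2 * Real.log 2 / τ * q ^ 2) *
      (eta₂₂ 1 τ (bpar τ l₁ l₂ 0).1 (bpar τ l₁ l₂ 0).2.1 (bpar τ l₁ l₂ 0).2.2 (-q) *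
      (eta₂₂ 1 τ (bpar τ l₁ l₂ 1).1 (bpar τ l₁ l₂ 1).2.1 (bpar τ l₁ l₂ 1).2.2 (-q) *
      eta₂₂ 1 τ (bpar τ l₁ l₂ 2).1 (bpar τ l₁ l₂ 2).2.1 (bpar τ l₁ l₂ 2).2.2 (-q)))) := by
  have hc : (((2 : ℝ) ^ (-(3 * (1 + τ) + 2 * τ * (l₁ + l₂)) / τ) : ℝ) : ℂ) ^ q =
      Complex.exp (q * ((-(3 * (1 + τ) + 2 * τ * (l₁ + l₂)) / τ : ℝ) * Real.log 2 : ℝ)) := by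
    rw [← ofReal_exp_cpow, Real.rpow_def_of_pos two_pos, mul_comm (Real.log 2)]
  -- Duplication at $w=(x_1+x_2)/2-q$. Its four shifts are the arguments occurring in $X_2$; the
  -- terms with net coefficient $-1$ at $w$ and $w+(1+\tau)/2$ arise as $1-2$, the $-2$ coming from
  -- $X_1$ and $X_3$ respectively.
  have dup : ∀ q : ℂ, q.re < xpar τ l₁ → q.re < xpar τ l₂ →
      logGamma₂ 1 τ (xpar τ l₁ + xpar τ l₂ - 2 * q) = _ := fun q p₁ p₂ => by
    have hw : 0 < (((xpar τ l₁ + xpar τ l₂ : ℝ) : ℂ) / 2 - q).re := by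
      rw [Complex.sub_re, show (2 : ℂ) = ((2 : ℝ) : ℂ) by simp, ← Complex.ofReal_div,
        Complex.ofReal_re]
      linarith
    have hw2 : 0 < (2 * (((xpar τ l₁ + xpar τ l₂ : ℝ) : ℂ) / 2 - q)).re := by simpa using hw
    have e : (xpar τ l₁ + xpar τ l₂ - 2 * q : ℂ) =
        2 * (((xpar τ l₁ + xpar τ l₂ : ℝ) : ℂ) / 2 - q) := by push_cast; ring
    rw [e, logGamma₂_two_mul one_pos hτ hw, zeta₂_zero one_pos hτ hw2]
  have dq := dup q hq₁ hq₂
  have d0 := dup 0 (by simpa using h₁) (by simpa using h₂)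
  have hτ' : (τ : ℂ) ≠ 0 := Complex.ofReal_ne_zero.2 hτ.ne'
  rw [hc]
  simp only [mellinM, Gamma₂, eta₂₂, ← Complex.exp_sub, ← Complex.exp_add]
  congr 1
  generalize iteratedDeriv 2 (fun z => todd 1 z * todd τ z) 0 = K at dq d0
  generalize logGamma₂ 1 τ = G at *
  generalize hX₁ : xpar τ l₁ = X₁ at *
  generalize hX₂ : xpar τ l₂ = X₂ at *
  simp only [S₂, bpar, hX₁, hX₂]
  -- This is the form in which the exponent of 2 appears as the linear coefficient of
  -- $\zeta_2(0,x_1+x_2-2q)$. The constant `K` cancels between `d0` and `dq`.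
  have hl : 3 * (1 + (τ : ℂ)) + 2 * τ * (l₁ + l₂) = 2 * X₁ + 2 * X₂ - 1 - τ := by
    rw [← hX₁, ← hX₂]; simp only [xpar]; push_cast; ring
  push_cast at dq d0 ⊢
  rw [hl]
  ring_nf at dq d0 ⊢
  linear_combination d0 - dq

end Factors

/-! ### The law `M_(a,x)` and the reduced Selberg law -/

/-- The constant factor in `M_(a,x)`. -/
def constM (τ l₁ l₂ : ℝ) : ℝ := (2 : ℝ) ^ (-(3 * (1 + τ) + 2 * τ * (l₁ + l₂)) / τ)

lemma constM_pos (τ l₁ l₂ : ℝ) : 0 < constM τ l₁ l₂ := Real.rpow_pos_of_pos two_pos _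

lemma mul_mem_Ioi_zero : ∀ x ∈ Ioi (0 : ℝ), ∀ y ∈ Ioi (0 : ℝ), x * y ∈ Ioi (0 : ℝ) :=
  fun _ hx _ hy => mem_Ioi.2 (mul_pos hx hy)

lemma mconv_map_right (μ : Measure ℝ) [SFinite μ] {α : Type*} [MeasurableSpace α]
    (ρ : Measure α) [SFinite ρ] {f : α → ℝ} (hf : Measurable f) :
    μ.mconv (ρ.map f) = (μ.prod ρ).map fun p => p.1 * f p.2 := by
  have h := Measure.map_prod_map μ ρ measurable_id hf
  rw [Measure.map_id] at h
  rw [Measure.mconv, h, Measure.map_map (by fun_prop) (by fun_prop)]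
  rfl

instance sfinite_lawL (τ : ℝ) : SFinite (lawL τ) := by unfold lawL; infer_instance

instance sfinite_lawY (τ : ℝ) : SFinite (lawY τ) := by unfold lawY; infer_instance

section Selberg

variable {τ l₁ l₂ : ℝ} (hτ : 0 < τ) (h₁ : 0 < xpar τ l₁) (h₂ : 0 < xpar τ l₂)

include hτ h₁ h₂

lemma sfinite_lawX (i : Fin 3) : SFinite (lawX i τ l₁ l₂) := by
  have := (hasMellin_lawX hτ h₁ h₂ i).1
  infer_instance

/-- The domain of the Mellin transform of `M_(a,x)`. -/
def domM (τ l₁ l₂ : ℝ) : Set ℂ := {q | q.re < min (min (xpar τ l₁) (xpar τ l₂)) (1 + τ)}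

omit hτ h₁ h₂ in
lemma mem_domM {q : ℂ} : q ∈ domM τ l₁ l₂ ↔
    q.re < xpar τ l₁ ∧ q.re < xpar τ l₂ ∧ q.re < 1 + τ := by
  simp only [domM, mem_ofPred_eq, lt_min_iff, and_assoc]

lemma mem_domM_of_re_nonpos {q : ℂ} (hq : q.re ≤ 0) : q ∈ domM τ l₁ l₂ :=
  mem_domM.2 ⟨by linarith, by linarith, by linarith⟩

lemma mellinOn_lawX (i : Fin 3) : MellinOn (Ioi 0) (domM τ l₁ l₂)
    (fun q => eta₂₂ 1 τ (bpar τ l₁ l₂ i).1 (bpar τ l₁ l₂ i).2.1 (bpar τ l₁ l₂ i).2.2 (-q))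
    (lawX i τ l₁ l₂) :=
  (HasMellin.mellinOn (hasMellin_lawX hτ h₁ h₂ i)).mono subset_rfl
    (fun _ hq => le_absX hτ h₂ i (mem_domM.1 hq).1 (mem_domM.1 hq).2.1 (mem_domM.1 hq).2.2)
    fun _ _ => rfl

omit h₁ h₂ hτ in
lemma mellinM_zero : mellinM 1 τ (xpar τ l₁) (xpar τ l₂) 0 = 1 := by
  simp [mellinM, Gamma₂]

/-- By `mellinM_eq`, the independent product of the constant, $L$ and the three $X_i$ has the
required transform. -/
theorem existsUnique_isLawM : ∃! μ : Measure ℝ, IsLawM 1 τ (xpar τ l₁) (xpar τ l₂) μ := by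
  have := fun i => sfinite_lawX hτ h₁ h₂ i
  have hX := fun i => mellinOn_lawX hτ h₁ h₂ i
  have hL : MellinOn (Ioi 0) (domM τ l₁ l₂) _ (lawL τ) :=
    (mellinOn_lawL hτ).mono (ψ := _) subset_rfl (subset_univ _) fun q _ => rfl
  have hM := (mellinOn_dirac (constM_pos τ l₁ l₂) measurableSet_Ioi (domM τ l₁ l₂)).mconv
    (hL.mconv ((hX 0).mconv ((hX 1).mconv (hX 2) measurableSet_Ioi subset_rfl mul_mem_Ioi_zero)
      measurableSet_Ioi subset_rfl mul_mem_Ioi_zero) measurableSet_Ioi subset_rfl mul_mem_Ioi_zero)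
    measurableSet_Ioi subset_rfl mul_mem_Ioi_zero
  have hH := (hM.mono (ψ := mellinM 1 τ (xpar τ l₁) (xpar τ l₂)) subset_rfl subset_rfl
    fun q hq => (mellinM_eq hτ h₁ h₂ (mem_domM.1 hq).1 (mem_domM.1 hq).2.1).symm).hasMellin
    (mem_domM_of_re_nonpos hτ h₁ h₂ le_rfl) mellinM_zero
  exact ⟨_, hH, fun ν hν => HasMellin.unique hν hH subset_rfl fun t =>
    mem_domM_of_re_nonpos hτ h₁ h₂ (re_ofReal_mul_I t).le⟩

lemma hasMellin_lawM : HasMellin (Ioi 0) (domM τ l₁ l₂)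
    (mellinM 1 τ (xpar τ l₁) (xpar τ l₂)) (lawM 1 τ (xpar τ l₁) (xpar τ l₂)) :=
  Classical.epsilon_spec (p := IsLawM 1 τ (xpar τ l₁) (xpar τ l₂))
    (existsUnique_isLawM hτ h₁ h₂).exists

lemma lawMstar_eq_mconv : lawMstar τ l₁ l₂ = (Measure.dirac (constM τ l₁ l₂)).mconv
    ((lawL τ).mconv ((lawX 0 τ l₁ l₂).mconv ((lawX 1 τ l₁ l₂).mconv
      ((lawX 2 τ l₁ l₂).mconv (lawY τ))))) := by
  have := fun i => sfinite_lawX hτ h₁ h₂ i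
  have hXY : (lawX 2 τ l₁ l₂).mconv (lawY τ) =
      ((lawX 2 τ l₁ l₂).prod (lawY τ)).map fun p => p.1 * p.2 := rfl
  rw [hXY, mconv_map_right _ _ (by fun_prop), mconv_map_right _ _ (by fun_prop),
    mconv_map_right _ _ (by fun_prop), Measure.dirac_mconv,
    Measure.map_map (by fun_prop) (by fun_prop), lawMstar]
  congr 1
  ext p
  simp only [Function.comp_apply, constM]
  ring

/-- The Mellin transform of the reduced Selberg law. -/
theorem mellinOn_lawMstar : MellinOn (Ioi 0) (domM τ l₁ l₂ ∩ {q | q.re < τ})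
    (fun q => mellinM 1 τ (xpar τ l₁) (xpar τ l₂) q * Complex.Gamma (1 - q / τ))
    (lawMstar τ l₁ l₂) := by
  have := fun i => sfinite_lawX hτ h₁ h₂ i
  have hX := fun i => (mellinOn_lawX hτ h₁ h₂ i).mono (ψ := _) (D' := domM τ l₁ l₂ ∩ {q | q.re < τ})
    subset_rfl inter_subset_left fun q _ => rfl
  have hL : MellinOn (Ioi 0) (domM τ l₁ l₂ ∩ {q | q.re < τ}) _ (lawL τ) :=
    (mellinOn_lawL hτ).mono (ψ := _) subset_rfl (subset_univ _) fun q _ => rfl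
  have hY : MellinOn (Ioi 0) (domM τ l₁ l₂ ∩ {q | q.re < τ}) _ (lawY τ) :=
    (mellinOn_lawY hτ).mono (ψ := _) subset_rfl inter_subset_right fun q _ => rfl
  have hM := (mellinOn_dirac (constM_pos τ l₁ l₂) measurableSet_Ioi
      (domM τ l₁ l₂ ∩ {q | q.re < τ})).mconv
    (hL.mconv ((hX 0).mconv ((hX 1).mconv ((hX 2).mconv hY
      measurableSet_Ioi subset_rfl mul_mem_Ioi_zero) measurableSet_Ioi subset_rfl mul_mem_Ioi_zero)
      measurableSet_Ioi subset_rfl mul_mem_Ioi_zero) measurableSet_Ioi subset_rfl mul_mem_Ioi_zero)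
    measurableSet_Ioi subset_rfl mul_mem_Ioi_zero
  rw [lawMstar_eq_mconv hτ h₁ h₂]
  refine hM.mono subset_rfl subset_rfl fun q hq => ?_
  rw [mellinM_eq hτ h₁ h₂ (mem_domM.1 hq.1).1 (mem_domM.1 hq.1).2.1, constM]
  ring

/-! ### The involution `τ ↦ 1/τ`, `λ ↦ τλ` -/

omit h₁ h₂ in
lemma xpar_involution (l : ℝ) : xpar (1 / τ) (τ * l) = xpar τ l / τ := by
  simp only [xpar]; field_simp; ring

omit h₁ h₂ in
-- The exchange of $b_1$ and $b_2$ is forced by $X_2$, whose increments $(1/2,\tau/2)$ divided by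
-- $\tau$ appear in the opposite order.
lemma bpar_involution (i : Fin 3) : bpar (1 / τ) (τ * l₁) (τ * l₂) i =
    ((bpar τ l₁ l₂ i).1 / τ, (bpar τ l₁ l₂ i).2.2 / τ, (bpar τ l₁ l₂ i).2.1 / τ) := by
  fin_cases i <;> simp only [bpar, xpar_involution hτ] <;> ext <;> simp only <;> field_simp <;> ring

omit h₁ h₂ in
lemma constM_involution (q : ℂ) :
    (constM (1 / τ) (τ * l₁) (τ * l₂) : ℂ) ^ (q / τ) = (constM τ l₁ l₂ : ℂ) ^ q := by
  have hτ' : (τ : ℂ) ≠ 0 := Complex.ofReal_ne_zero.2 hτ.ne'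
  simp only [constM, Real.rpow_def_of_pos two_pos, ofReal_exp_cpow]
  congr 1
  push_cast
  field_simp
  ring

omit h₁ h₂ in
lemma xpar_involution_pos {l : ℝ} (h : 0 < xpar τ l) : 0 < xpar (1 / τ) (τ * l) := by
  rw [xpar_involution hτ]; positivity

lemma eta₂₂_involution (i : Fin 3) {q : ℂ} (hq : q.re < absX i τ l₁ l₂) :
    eta₂₂ 1 (1 / τ) (bpar (1 / τ) (τ * l₁) (τ * l₂) i).1 (bpar (1 / τ) (τ * l₁) (τ * l₂) i).2.1
      (bpar (1 / τ) (τ * l₁) (τ * l₂) i).2.2 (-(q / τ)) =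
    eta₂₂ 1 τ (bpar τ l₁ l₂ i).1 (bpar τ l₁ l₂ i).2.1 (bpar τ l₁ l₂ i).2.2 (-q) := by
  obtain ⟨p0, p1, p2⟩ := absX_pos hτ h₁ h₂ i
  rw [bpar_involution hτ, ← neg_div]
  exact eta₂₂_scaling hτ p0 p1 p2 (by rw [Complex.neg_re]; exact neg_lt_neg hq)

/-- Checked factor by factor through `mellinM_eq`, so that no scaling law for $\Gamma_2$ itself is
needed. -/
lemma mellinM_involution {q : ℂ} (hq : q ∈ domM τ l₁ l₂) :
    mellinM 1 (1 / τ) (xpar (1 / τ) (τ * l₁)) (xpar (1 / τ) (τ * l₂)) (q / τ) =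
      mellinM 1 τ (xpar τ l₁) (xpar τ l₂) q := by
  obtain ⟨q1, q2, q3⟩ := mem_domM.1 hq
  have hτ' : (τ : ℂ) ≠ 0 := Complex.ofReal_ne_zero.2 hτ.ne'
  have hX : ∀ i, q.re < absX i τ l₁ l₂ := fun i => le_absX hτ h₂ i q1 q2 q3
  rw [mellinM_eq hτ h₁ h₂ q1 q2, mellinM_eq (one_div_pos.2 hτ) (xpar_involution_pos hτ h₁)
    (xpar_involution_pos hτ h₂), eta₂₂_involution hτ h₁ h₂ 0 (hX 0),
    eta₂₂_involution hτ h₁ h₂ 1 (hX 1), eta₂₂_involution hτ h₁ h₂ 2 (hX 2)]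
  · congr 1
    · exact constM_involution hτ q
    · congr 2
      push_cast
      field_simp
  · rw [xpar_involution hτ, Complex.div_ofReal_re]; gcongr
  · rw [xpar_involution hτ, Complex.div_ofReal_re]; gcongr

omit h₁ h₂ in
theorem powLaw_lawL : powLaw (lawL (1 / τ)) (1 / τ) = lawL τ := by
  have hτ' : (τ : ℂ) ≠ 0 := Complex.ofReal_ne_zero.2 hτ.ne'
  have h := (mellinOn_lawL (one_div_pos.2 hτ)).powLaw (T := Ioi 0) subset_rfl (r := 1 / τ)
    measurableSet_Ioi fun x hx => Real.rpow_pos_of_pos hx _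
  refine HasMellin.unique (S := Ioi 0) (D := univ) (MellinOn.hasMellin (h.mono
    (ψ := fun q => Complex.exp (2 * Real.log 2 / τ * q ^ 2)) subset_rfl (fun _ _ => trivial)
    fun q _ => ?_) trivial (by simp)) ((mellinOn_lawL hτ).hasMellin trivial (by simp)) subset_rfl
    fun t => trivial
  congr 1
  push_cast
  field_simp

theorem powLaw_lawX (i : Fin 3) :
    powLaw (lawX i (1 / τ) (τ * l₁) (τ * l₂)) (1 / τ) = lawX i τ l₁ l₂ := by
  have hX := hasMellin_lawX hτ h₁ h₂ i
  have h := (HasMellin.mellinOn (hasMellin_lawX (one_div_pos.2 hτ) (xpar_involution_pos hτ h₁)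
    (xpar_involution_pos hτ h₂) i)).powLaw (T := Ioi 0) subset_rfl (r := 1 / τ)
    measurableSet_Ioi fun x hx => Real.rpow_pos_of_pos hx _
  have habs : absX i (1 / τ) (τ * l₁) (τ * l₂) = absX i τ l₁ l₂ / τ := by
    simp only [absX, bpar_involution hτ]
    rw [← min_div_div_right hτ.le]; congr 1; ring
  have hmul : ∀ q : ℂ, ((1 / τ : ℝ) : ℂ) * q = q / τ := fun q => by push_cast; ring
  refine HasMellin.unique (MellinOn.hasMellin (h.mono subset_rfl (fun q hq => ?_)
    fun q hq => ?_) (absX_pos hτ h₁ h₂ i).1 (by simp [eta₂₂])) hX subset_rfl fun t => ?_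
  · have hq' : q.re < absX i τ l₁ l₂ := hq
    show (((1 / τ : ℝ) : ℂ) * q).re < _
    rw [hmul, habs, Complex.div_ofReal_re]
    gcongr
  · rw [hmul]; exact eta₂₂_involution hτ h₁ h₂ i hq
  · show ((t : ℂ) * Complex.I).re < _
    rw [re_ofReal_mul_I]; exact (absX_pos hτ h₁ h₂ i).1

omit h₁ h₂ in
lemma div_mem_domM_involution {q : ℂ} (hq : q ∈ domM τ l₁ l₂) :
    q / τ ∈ domM (1 / τ) (τ * l₁) (τ * l₂) := by
  obtain ⟨q1, q2, q3⟩ := mem_domM.1 hq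
  refine mem_domM.2 ⟨?_, ?_, ?_⟩
  · rw [xpar_involution hτ, Complex.div_ofReal_re]; gcongr
  · rw [xpar_involution hτ, Complex.div_ofReal_re]; gcongr
  · rw [Complex.div_ofReal_re, div_lt_iff₀ hτ]
    have : (1 + 1 / τ) * τ = 1 + τ := by field_simp; ring
    linarith

theorem powLaw_lawM :
    powLaw (lawM 1 (1 / τ) (xpar (1 / τ) (τ * l₁)) (xpar (1 / τ) (τ * l₂))) (1 / τ) =
      lawM 1 τ (xpar τ l₁) (xpar τ l₂) := by
  have h := (HasMellin.mellinOn (hasMellin_lawM (one_div_pos.2 hτ) (xpar_involution_pos hτ h₁)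
    (xpar_involution_pos hτ h₂))).powLaw (T := Ioi 0) subset_rfl (r := 1 / τ)
    measurableSet_Ioi fun x hx => Real.rpow_pos_of_pos hx _
  have hmul : ∀ q : ℂ, ((1 / τ : ℝ) : ℂ) * q = q / τ := fun q => by push_cast; ring
  refine HasMellin.unique (MellinOn.hasMellin (h.mono subset_rfl (fun q hq => ?_)
    fun q hq => ?_) (mem_domM_of_re_nonpos hτ h₁ h₂ le_rfl) mellinM_zero)
    (hasMellin_lawM hτ h₁ h₂) subset_rfl
    fun t => mem_domM_of_re_nonpos hτ h₁ h₂ (re_ofReal_mul_I t).le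
  · show ((1 / τ : ℝ) : ℂ) * q ∈ domM (1 / τ) (τ * l₁) (τ * l₂)
    rw [hmul]; exact div_mem_domM_involution hτ hq
  · rw [hmul]; exact mellinM_involution hτ h₁ h₂ hq

/-! ### The reduced Selberg law under the involution -/

/-- The Mellin transform of the transformed reduced Selberg law. -/
lemma mellin_lawMstar_involution {q : ℂ} (hq : q ∈ domM τ l₁ l₂) (hq1 : q.re < 1) :
    Integrable (fun x : ℝ => (x : ℂ) ^ (q / (τ : ℂ))) (lawMstar (1 / τ) (τ * l₁) (τ * l₂)) ∧
      ∫ x : ℝ, (x : ℂ) ^ (q / (τ : ℂ)) ∂(lawMstar (1 / τ) (τ * l₁) (τ * l₂)) =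
        mellinM 1 τ (xpar τ l₁) (xpar τ l₂) q * Complex.Gamma (1 - q) := by
  have hτ' : (τ : ℂ) ≠ 0 := Complex.ofReal_ne_zero.2 hτ.ne'
  have h := (mellinOn_lawMstar (one_div_pos.2 hτ) (xpar_involution_pos hτ h₁)
    (xpar_involution_pos hτ h₂)).2 (q / τ) ⟨div_mem_domM_involution hτ hq, by
      show (q / τ).re < 1 / τ
      rw [Complex.div_ofReal_re]; gcongr⟩
  have e : q / (τ : ℂ) / ((1 / τ : ℝ) : ℂ) = q := by push_cast; field_simp
  simp only [e, mellinM_involution hτ h₁ h₂ hq] at h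
  exact h

theorem powLaw_lawMstar_ne (hne : τ ≠ 1) :
    powLaw (lawMstar (1 / τ) (τ * l₁) (τ * l₂)) (1 / τ) ≠ lawMstar τ l₁ l₂ := by
  intro heq
  have hτ' : (τ : ℂ) ≠ 0 := Complex.ofReal_ne_zero.2 hτ.ne'
  have hP := (mellinOn_lawMstar (one_div_pos.2 hτ) (xpar_involution_pos hτ h₁)
    (xpar_involution_pos hτ h₂)).powLaw (T := Ioi 0) subset_rfl (r := 1 / τ)
    measurableSet_Ioi fun x hx => Real.rpow_pos_of_pos hx _
  have key : ∀ s : ℝ, 0 < s → Real.Gamma (1 + s) = Real.Gamma (1 + s / τ) := by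
    intro s hs
    have hre : (-(s : ℂ)).re = -s := by simp
    have hD : -(s : ℂ) ∈ domM τ l₁ l₂ := mem_domM_of_re_nonpos hτ h₁ h₂ (by rw [hre]; linarith)
    have hmul : ((1 / τ : ℝ) : ℂ) * -(s : ℂ) = -(s : ℂ) / τ := by push_cast; ring
    have e1 := (hP.2 (-(s : ℂ)) (by
      show ((1 / τ : ℝ) : ℂ) * -(s : ℂ) ∈ domM (1 / τ) (τ * l₁) (τ * l₂) ∩ {q | q.re < 1 / τ}
      rw [hmul]
      refine ⟨div_mem_domM_involution hτ hD, ?_⟩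
      show (-(s : ℂ) / τ).re < 1 / τ
      rw [Complex.div_ofReal_re, hre]
      gcongr
      linarith)).2
    have e2 := ((mellinOn_lawMstar hτ h₁ h₂).2 (-(s : ℂ)) ⟨hD, by
      show (-(s : ℂ)).re < τ
      rw [hre]; linarith⟩).2
    rw [heq, e2] at e1
    simp only [hmul] at e1
    rw [mellinM_involution hτ h₁ h₂ hD] at e1
    have hM : mellinM 1 τ (xpar τ l₁) (xpar τ l₂) (-(s : ℂ)) ≠ 0 := by
      simp [mellinM, Gamma₂, Complex.exp_ne_zero]
    have e3 := mul_left_cancel₀ hM e1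
    rw [show 1 - -(s : ℂ) / τ = ((1 + s / τ : ℝ) : ℂ) by push_cast; ring,
      show 1 - -(s : ℂ) / τ / ((1 / τ : ℝ) : ℂ) = ((1 + s : ℝ) : ℂ) by
        push_cast; field_simp; ring, Complex.Gamma_ofReal, Complex.Gamma_ofReal] at e3
    exact_mod_cast e3.symm
  have h2 : Real.Gamma (1 + 1) = 1 := by
    rw [Real.Gamma_add_one one_ne_zero, Real.Gamma_one, one_mul]
  have hlt : ∀ s : ℝ, 1 < s → Real.Gamma (1 + 1) < Real.Gamma (1 + s) := fun s hs =>
    Real.Gamma_strictMonoOn_Ici (by norm_num) (mem_Ici.2 (by linarith)) (by linarith)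
  -- Choose $s$ so that one of the two arguments is 2 and the other exceeds 2, where $\Gamma$ is
  -- strictly increasing: $s=1$ if $\tau<1$, and $s=\tau$ if $\tau>1$.
  rcases lt_or_gt_of_ne hne with h | h
  · exact (hlt _ ((one_lt_div hτ).2 h)).ne (key 1 one_pos)
  · have := key τ hτ
    rw [div_self hτ.ne'] at this
    exact (hlt _ h).ne this.symm

end Selberg

end BarnesSelberg

end

theorem mainTheorem9 (τ l₁ l₂ : ℝ) (hτ : 0 < τ)
    (h₁ : 0 < BarnesSelberg.xpar τ l₁) (h₂ : 0 < BarnesSelberg.xpar τ l₂) :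
    -- the laws are well defined
    (∀ i : Fin 3, ∃! μ : Measure ℝ, BarnesSelberg.IsBarnesBeta₂₂ 1 τ
      (BarnesSelberg.bpar τ l₁ l₂ i).1 (BarnesSelberg.bpar τ l₁ l₂ i).2.1
      (BarnesSelberg.bpar τ l₁ l₂ i).2.2 μ) ∧
    (∃! μ : Measure ℝ, BarnesSelberg.IsLawM 1 τ
      (BarnesSelberg.xpar τ l₁) (BarnesSelberg.xpar τ l₂) μ) ∧
    -- involution invariance of the lognormal, of the three factors and of their combination
    BarnesSelberg.powLaw (BarnesSelberg.lawL (1 / τ)) (1 / τ) = BarnesSelberg.lawL τ ∧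
    (∀ i : Fin 3, BarnesSelberg.powLaw (BarnesSelberg.lawX i (1 / τ) (τ * l₁) (τ * l₂)) (1 / τ) =
      BarnesSelberg.lawX i τ l₁ l₂) ∧
    BarnesSelberg.powLaw (BarnesSelberg.lawM 1 (1 / τ)
        (BarnesSelberg.xpar (1 / τ) (τ * l₁)) (BarnesSelberg.xpar (1 / τ) (τ * l₂))) (1 / τ) =
      BarnesSelberg.lawM 1 τ (BarnesSelberg.xpar τ l₁) (BarnesSelberg.xpar τ l₂) ∧
    -- the reduced Selberg law is not invariant, except in the trivial case `τ = 1`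
    (τ ≠ 1 → BarnesSelberg.powLaw (BarnesSelberg.lawMstar (1 / τ) (τ * l₁) (τ * l₂)) (1 / τ) ≠
      BarnesSelberg.lawMstar τ l₁ l₂) ∧
    -- the transformation of its Mellin transform
    (∀ q : ℂ, q.re < 1 → q.re < τ →
      q.re < BarnesSelberg.xpar τ l₁ → q.re < BarnesSelberg.xpar τ l₂ →
      Integrable (fun x : ℝ => (x : ℂ) ^ (q / (τ : ℂ)))
        (BarnesSelberg.lawMstar (1 / τ) (τ * l₁) (τ * l₂)) ∧
      Integrable (fun x : ℝ => (x : ℂ) ^ q) (BarnesSelberg.lawMstar τ l₁ l₂) ∧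
      ∫ x : ℝ, (x : ℂ) ^ (q / (τ : ℂ)) ∂(BarnesSelberg.lawMstar (1 / τ) (τ * l₁) (τ * l₂)) =
        Complex.Gamma (1 - q) / Complex.Gamma (1 - q / (τ : ℂ)) *
          ∫ x : ℝ, (x : ℂ) ^ q ∂(BarnesSelberg.lawMstar τ l₁ l₂)) := by
  refine ⟨BarnesSelberg.existsUnique_isBarnesBeta₂₂ hτ h₁ h₂,
    BarnesSelberg.existsUnique_isLawM hτ h₁ h₂, BarnesSelberg.powLaw_lawL hτ,
    BarnesSelberg.powLaw_lawX hτ h₁ h₂, BarnesSelberg.powLaw_lawM hτ h₁ h₂,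
    BarnesSelberg.powLaw_lawMstar_ne hτ h₁ h₂, fun q hq1 hqτ hx₁ hx₂ => ?_⟩
  have hD : q ∈ BarnesSelberg.domM τ l₁ l₂ :=
    BarnesSelberg.mem_domM.2 ⟨hx₁, hx₂, by linarith⟩
  have hM := BarnesSelberg.mellin_lawMstar_involution hτ h₁ h₂ hD hq1
  have hS := (BarnesSelberg.mellinOn_lawMstar hτ h₁ h₂).2 q ⟨hD, hqτ⟩
  refine ⟨hM.1, hS.1, ?_⟩
  have hΓ : Complex.Gamma (1 - q / (τ : ℂ)) ≠ 0 := by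
    refine Complex.Gamma_ne_zero_of_re_pos ?_
    rw [Complex.sub_re, Complex.div_ofReal_re, Complex.one_re, sub_pos, div_lt_one hτ]
    exact hqτ
  rw [hM.2, hS.2]
  field_simp
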